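/- **Setting.** Hilbert spaces are complex; $L(\mathcal U,\mathcal Y)$ denotes the bounded linear operators and $L(\mathcal U)=L(\mathcal U,\mathcal U)$. Fix $N$ and sizes $n_1,\ldots,n_N$, and consider tuples $Z=(Z_1,\ldots,Z_N)$ with $Z_k\in\mathbb C^{n_k\times n_k}$; write $\bar Z$ for the tuple of entrywise complex conjugates. Let $$\Pi:=\{Z:\ Z_k+Z_k^*>0,\ k=1,\ldots,N\},\qquad \Omega_{n_1,\ldots,n_N}:=\bigcup_{|\lambda|=1}\lambda\,\Pi,\qquad \mathbb D:=\{W:\ W_kW_k^*<I_{n_k},\ k=1,\ldots,N\}.$$ An *anti-unitary involution* (AUI) on a Hilbert space $\mathcal U$ is a map $\iota:\mathcal U\to\mathcal U$ with $\iota^2=I_{\mathcal U}$ and $\langle\iota u,\iota v\rangle=\langle v,u\rangle$ for all $u,v$ (it is automatically anti-linear). Let $\iota_n$ be the entrywise complex conjugation on $\mathbb C^n$; for AUIs, $\iota_{\mathcal U}\oplus\iota_{\mathcal H}$ and $\iota_n\otimes\iota_{\mathcal M}$ are the induced AUIs on $\mathcal U\oplus\mathcal H$ and $\mathbb C^n\otimes\mathcal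 M$. An operator $A\in L(\mathcal U,\mathcal Y)$ is $(\iota_{\mathcal U},\iota_{\mathcal Y})$-*real* if $\iota_{\mathcal Y}A=A\iota_{\mathcal U}$. An $L(\mathcal U,\mathcal Y)$-valued function $g$ on a conjugation-invariant set $S$ of tuples is $(\iota_{\mathcal U},\iota_{\mathcal Y})$-*real* if $\iota_{\mathcal Y}\,g(\bar Z)\,\iota_{\mathcal U}=g(Z)$ for all $Z\in S$. If $\mathcal Y=\mathcal U$ and $\iota_{\mathcal Y}=\iota_{\mathcal U}=\iota$, one says $\iota$-real. A *long resolvent representation* of $f:\Omega_{n_1,\ldots,n_N}\to L(\mathcal U)$ consists of Hilbert spaces $\mathcal H,\mathcal M_1,\ldots,\mathcal M_N$ and operators $G_k\in L(\mathcal U\oplus\mathcal H,\mathbb C^{n_k}\otimes\mathcal M_k)$ such that, with $$A(Z)=\sum_{k=1}^N G_k^*(Z_k\otimes I_{\mathcal M_k})G_k=\begin{bmatrix}a(Z)&b(Z)\\ c(Z)&d(Z)\end{bmatrix}\in L(\mathcal U\oplus\mathcal H),$$ the operator $d(Z)$ is boundedly invertible and $f(Z)=a(Z)-b(Z)d(Z)^{-1}c(Z)$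 for all $Z\in\Omega_{n_1,\ldots,n_N}$. The *Bessmertnyĭ class* $\mathcal B_{n_1,\ldots,n_N}(\mathcal U)$ is the set of all holomorphic $f:\Omega_{n_1,\ldots,n_N}\to L(\mathcal U)$ that have a long resolvent representation. For $W\in\mathbb D$ put $Z(W)=\big((I+W_k)(I-W_k)^{-1}\big)_{k=1}^N\in\Pi$. The *double Cayley transform* of $f$ is $\mathcal C(f)(W)=[f(Z(W))-I_{\mathcal U}]\,[f(Z(W))+I_{\mathcal U}]^{-1}$, $W\in\mathbb D$; it is *defined* if $f(Z(W))+I_{\mathcal U}$ is boundedly invertible for every $W\in\mathbb D$. **Theorem.** Let $\iota=\iota_{\mathcal U}$ be an AUI on a Hilbert space $\mathcal U$, and let $f$ be a holomorphic $L(\mathcal U)$-valued function on $\Omega_{n_1,\ldots,n_N}$. The following statements are equivalent. (i) $f\in\mathcal B_{n_1,\ldots,n_N}(\mathcal U)$ and $f$ is $\iota$-real. (ii) There are a long resolvent representation of $f$ and AUIs $\iota_{\mathcal H}$ on $\mathcal H$ and $\iota_{\mathcal M_k}$ on $\mathcal M_k$ such that each $G_k$ is $(\iota_{\mathcal U}\oplus\iota_{\mathcal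 H},\ \iota_{n_k}\otimes\iota_{\mathcal M_k})$-real, $k=1,\ldots,N$. (iii) There are Hilbert spaces $\mathcal M_k$ with AUIs $\iota_{\mathcal M_k}$ and holomorphic functions $\varphi_k:\Pi\to L(\mathcal U,\mathbb C^{n_k}\otimes\mathcal M_k)$, each $(\iota_{\mathcal U},\iota_{n_k}\otimes\iota_{\mathcal M_k})$-real, $k=1,\ldots,N$, such that $$f(Z)=\sum_{k=1}^N\varphi_k(\Lambda)^*(Z_k\otimes I_{\mathcal M_k})\varphi_k(Z),\qquad Z,\Lambda\in\Pi.$$ (iv) $\mathcal F=\mathcal C(f)$ is defined, and there are a Hilbert space $\mathcal X$, an AUI $\iota_{\mathcal X}$ on $\mathcal X$ and an operator $$U=\begin{bmatrix}A&B\\ C&D\end{bmatrix}\in L\big((\mathbb C^{n_1+\cdots+n_N}\otimes\mathcal X)\oplus\mathcal U\big),\qquad U=U^*=U^{-1},$$ such that $U$ is $\big((\iota_{n_1+\cdots+n_N}\otimes\iota_{\mathcal X})\oplus\iota_{\mathcal U}\big)$-real and, with $P(W)=\operatorname{diag}(W_1,\ldots,W_N)$, $$\mathcal F(W)=D+C(P(W)\otimes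 I_{\mathcal X})\big(I-A(P(W)\otimes I_{\mathcal X})\big)^{-1}B,\qquad W\in\mathbb D.$$ -/

import Mathlib

open scoped Matrix ComplexOrder Matrix.Norms.L2Operator

universe u

namespace Bessmertnyi

noncomputable section

/-! ### Anti-unitary involutions and real operators -/

/-- An anti-unitary involution (AUI) on an inner product space: a map `ι` with `ι² = I` and
`⟨ι u, ι v⟩ = ⟨v, u⟩`. Anti-linearity is a consequence (`AUI.map_add`, `AUI.map_smul`). -/
structure AUI (E : Type*) [NormedAddCommGroup E] [InnerProductSpace ℂ E] where
  toFun : E → E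
  invol : ∀ x, toFun (toFun x) = x
  inner_map : ∀ x y, inner ℂ (toFun x) (toFun y) = inner ℂ y x

instance {E : Type*} [NormedAddCommGroup E] [InnerProductSpace ℂ E] :
    CoeFun (AUI E) (fun _ => E → E) := ⟨AUI.toFun⟩

section AUI

variable {E F : Type*} [NormedAddCommGroup E] [InnerProductSpace ℂ E]
  [NormedAddCommGroup F] [InnerProductSpace ℂ F]

theorem AUI.inner_left (ι : AUI E) (x y : E) : inner ℂ (ι x) y = inner ℂ (ι y) x := by
  have h := ι.inner_map x (ι y)
  rwa [ι.invol] at h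

theorem AUI.map_add (ι : AUI E) (x y : E) : ι (x + y) = ι x + ι y := by
  refine ext_inner_right ℂ fun v => ?_
  rw [inner_add_left, ι.inner_left, inner_add_right, ι.inner_left x, ι.inner_left y]

theorem AUI.map_smul (ι : AUI E) (c : ℂ) (x : E) : ι (c • x) = starRingEnd ℂ c • ι x := by
  refine ext_inner_right ℂ fun v => ?_
  rw [inner_smul_left, ι.inner_left, inner_smul_right, ι.inner_left x]
  simp

/-- The AUI `ι_E ⊕ ι_F` on the Hilbert direct sum `E ⊕ F`. -/
def AUI.prod (ι : AUI E) (κ : AUI F) : AUI (WithLp 2 (E × F)) where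
  toFun x := WithLp.toLp 2 (ι x.fst, κ x.snd)
  invol x := by
    apply (WithLp.equiv 2 (E × F)).injective
    simp [ι.invol, κ.invol]
    rfl
  inner_map x y := by
    simp [WithLp.prod_inner_apply, ι.inner_map, κ.inner_map]

/-- An operator `A ∈ L(E, F)` is `(ι_E, ι_F)`-real if `ι_F A = A ι_E`. -/
def IsRealOp (ι : AUI E) (κ : AUI F) (A : E →L[ℂ] F) : Prop :=
  ∀ x, κ (A x) = A (ι x)

end AUI

/-! ### The Hilbert space `ℂ^s ⊗ E` -/

section Tensor

variable {s : Type*} [Fintype s] {E : Type*} [NormedAddCommGroup E] [InnerProductSpace ℂ E]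

/-- The Hilbert space `ℂ^s ⊗ E` (for a finite index set `s`), realised as the Hilbert space of
columns `(x_i)_{i ∈ s}` with entries in `E`; the elementary tensors are `tmul v e = (v_i e)_i`. -/
abbrev Tensor (s : Type*) [Fintype s] (E : Type*) [NormedAddCommGroup E]
    [InnerProductSpace ℂ E] : Type _ :=
  PiLp 2 (fun _ : s => E)

/-- The elementary tensor `v ⊗ e`. -/
def tmul (v : s → ℂ) (e : E) : Tensor s E := WithLp.toLp 2 fun i => v i • e

theorem inner_tmul (v w : s → ℂ) (e e' : E) :
    inner ℂ (tmul v e) (tmul w e') = (∑ i, w i * starRingEnd ℂ (v i)) * inner ℂ e e' := by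
  simp only [tmul, PiLp.inner_apply, inner_smul_left, inner_smul_right, Finset.sum_mul]
  exact Finset.sum_congr rfl fun i _ => by ring

theorem eq_sum_tmul [DecidableEq s] (x : Tensor s E) :
    x = ∑ i, tmul (Pi.single i 1) (x i) := by
  ext j
  simp [tmul, Pi.single_apply]

/-- The operator `Z ⊗ I_E` on `ℂ^s ⊗ E`. -/
def ampl (Z : Matrix s s ℂ) : Tensor s E →L[ℂ] Tensor s E :=
  (PiLp.continuousLinearEquiv 2 ℂ (fun _ : s => E)).symm.toContinuousLinearMap ∘L
    ContinuousLinearMap.pi fun i => ∑ j, Z i j • PiLp.proj 2 (𝕜 := ℂ) (fun _ : s => E) j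

theorem ampl_apply (Z : Matrix s s ℂ) (x : Tensor s E) (i : s) :
    ampl Z x i = ∑ j, Z i j • x j := by
  simp [ampl]

theorem ampl_tmul (Z : Matrix s s ℂ) (v : s → ℂ) (e : E) :
    ampl Z (tmul v e) = tmul (Z *ᵥ v) e := by
  ext i
  simp [ampl_apply, tmul, Matrix.mulVec, dotProduct, Finset.sum_smul, smul_smul]

/-- The AUI `ι_s ⊗ ι_E` on `ℂ^s ⊗ E`, with `ι_s` the entrywise complex conjugation of `ℂ^s`. -/
def AUI.tensor (s : Type*) [Fintype s] (ι : AUI E) : AUI (Tensor s E) where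
  toFun x := WithLp.toLp 2 fun i => ι (x i)
  invol x := by
    ext i
    simp [ι.invol]
  inner_map x y := by
    simp [PiLp.inner_apply, ι.inner_map]

theorem AUI.tensor_tmul (ι : AUI E) (v : s → ℂ) (e : E) :
    AUI.tensor s ι (tmul v e) = tmul (star v) (ι e) := by
  ext i
  simp [AUI.tensor, tmul, ι.map_smul]

end Tensor

/-! ### Blocks of an operator on `E ⊕ F` -/

section Blocks

variable {E F : Type*} [NormedAddCommGroup E] [InnerProductSpace ℂ E]
  [NormedAddCommGroup F] [InnerProductSpace ℂ F]

/-- The embedding `E → E ⊕ F`. -/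
def inlL (E F : Type*) [NormedAddCommGroup E] [InnerProductSpace ℂ E]
    [NormedAddCommGroup F] [InnerProductSpace ℂ F] : E →L[ℂ] WithLp 2 (E × F) :=
  (WithLp.prodContinuousLinearEquiv 2 ℂ E F).symm.toContinuousLinearMap ∘L
    ContinuousLinearMap.inl ℂ E F

/-- The embedding `F → E ⊕ F`. -/
def inrL (E F : Type*) [NormedAddCommGroup E] [InnerProductSpace ℂ E]
    [NormedAddCommGroup F] [InnerProductSpace ℂ F] : F →L[ℂ] WithLp 2 (E × F) :=
  (WithLp.prodContinuousLinearEquiv 2 ℂ E F).symm.toContinuousLinearMap ∘L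
    ContinuousLinearMap.inr ℂ E F

/-- The upper left block. -/
def block11 (T : WithLp 2 (E × F) →L[ℂ] WithLp 2 (E × F)) : E →L[ℂ] E :=
  WithLp.fstL 2 ℂ E F ∘L T ∘L inlL E F

/-- The upper right block. -/
def block12 (T : WithLp 2 (E × F) →L[ℂ] WithLp 2 (E × F)) : F →L[ℂ] E :=
  WithLp.fstL 2 ℂ E F ∘L T ∘L inrL E F

/-- The lower left block. -/
def block21 (T : WithLp 2 (E × F) →L[ℂ] WithLp 2 (E × F)) : E →L[ℂ] F :=
  WithLp.sndL 2 ℂ E F ∘L T ∘L inlL E F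

/-- The lower right block. -/
def block22 (T : WithLp 2 (E × F) →L[ℂ] WithLp 2 (E × F)) : F →L[ℂ] F :=
  WithLp.sndL 2 ℂ E F ∘L T ∘L inrL E F

end Blocks

/-! ### Domains -/

section Domains

variable {N : ℕ} (n : Fin N → ℕ)

/-- Tuples `Z = (Z_1, …, Z_N)` of square complex matrices of sizes `n_1, …, n_N`. -/
abbrev Tuple : Type := ∀ k, Matrix (Fin (n k)) (Fin (n k)) ℂ

/-- The product of matrix halfplanes: `Z_k + Z_k^* > 0` for all `k`. -/
def halfplane : Set (Tuple n) := {Z | ∀ k, (Z k + (Z k)ᴴ).PosDef}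

/-- `Ω_{n_1,…,n_N}`: the union of the rotations `λ Π^{n_1×n_1} × ⋯ × λ Π^{n_N×n_N}`, `|λ| = 1`. -/
def Omega : Set (Tuple n) := {Z | ∃ c : ℂ, ‖c‖ = 1 ∧ ∃ Y ∈ halfplane n, Z = c • Y}

/-- The product of open matrix unit disks: `W_k W_k^* < I` for all `k`. -/
def disk : Set (Tuple n) := {W | ∀ k, (1 - W k * (W k)ᴴ).PosDef}

variable {n}

/-- The entrywise complex conjugate of a tuple of matrices. -/
def conjTuple (Z : Tuple n) : Tuple n := fun k => (Z k).map (starRingEnd ℂ)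

/-- The Cayley transform over the variables. -/
def cayley (W : Tuple n) : Tuple n := fun k => (1 + W k) * (1 - W k)⁻¹

/-- An `L(E, F)`-valued function `f` on a set `S` of tuples is `(ι_E, ι_F)`-real if
`ι_F f(conj Z) ι_E = f(Z)` for all `Z ∈ S`. -/
def IsRealFun {E F : Type*} [NormedAddCommGroup E] [InnerProductSpace ℂ E]
    [NormedAddCommGroup F] [InnerProductSpace ℂ F] (ι : AUI E) (κ : AUI F)
    (S : Set (Tuple n)) (f : Tuple n → E →L[ℂ] F) : Prop :=
  ∀ Z ∈ S, ∀ x, κ (f (conjTuple Z) (ι x)) = f Z x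

end Domains

/-! ### Representations -/

section Representations

variable {N : ℕ} {n : Fin N → ℕ}
  {U : Type*} [NormedAddCommGroup U] [InnerProductSpace ℂ U] [CompleteSpace U]
  {H : Type*} [NormedAddCommGroup H] [InnerProductSpace ℂ H] [CompleteSpace H]
  {M : Fin N → Type*} [∀ k, NormedAddCommGroup (M k)] [∀ k, InnerProductSpace ℂ (M k)]
  [∀ k, CompleteSpace (M k)]

/-- The pencil `A(Z) = ∑ G_k^* (Z_k ⊗ I) G_k` on `U ⊕ H`. -/
def pencil (G : ∀ k, WithLp 2 (U × H) →L[ℂ] Tensor (Fin (n k)) (M k)) (Z : Tuple n) :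
    WithLp 2 (U × H) →L[ℂ] WithLp 2 (U × H) :=
  ∑ k, ContinuousLinearMap.adjoint (G k) ∘L ampl (Z k) ∘L G k

/-- Long resolvent representation: for every `Z ∈ Ω`, with `a, b, c, d` the blocks of `A(Z)`,
the operator `d` is boundedly invertible and `f(Z) = a - b d⁻¹ c`. -/
def IsLongResolvent (f : Tuple n → U →L[ℂ] U)
    (G : ∀ k, WithLp 2 (U × H) →L[ℂ] Tensor (Fin (n k)) (M k)) : Prop :=
  ∀ Z ∈ Omega n, IsUnit (block22 (pencil G Z)) ∧
    f Z = block11 (pencil G Z) -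
      block12 (pencil G Z) ∘L Ring.inverse (block22 (pencil G Z)) ∘L block21 (pencil G Z)

/-- The functions `φ_k` are holomorphic on the product of halfplanes, and
`f(Z) = ∑ φ_k(Λ)^* (Z_k ⊗ I) φ_k(Z)` for all `Z, Λ` in it. -/
def IsDecomposition (f : Tuple n → U →L[ℂ] U)
    (φ : ∀ k, Tuple n → U →L[ℂ] Tensor (Fin (n k)) (M k)) : Prop :=
  (∀ k, DifferentiableOn ℂ (φ k) (halfplane n)) ∧
  ∀ Z ∈ halfplane n, ∀ Y ∈ halfplane n,
    f Z = ∑ k, ContinuousLinearMap.adjoint (φ k Y) ∘L ampl (Z k) ∘L φ k Z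

/-- The double Cayley transform of `f` is well defined on the product of disks. -/
def DoubleCayleyDefined (f : Tuple n → U →L[ℂ] U) : Prop :=
  ∀ W ∈ disk n, IsUnit (f (cayley W) + 1)

/-- The double Cayley transform `C(f)`. -/
def doubleCayley (f : Tuple n → U →L[ℂ] U) (W : Tuple n) : U →L[ℂ] U :=
  (f (cayley W) - 1) * Ring.inverse (f (cayley W) + 1)

/-- The index set of `ℂ^{n_1+⋯+n_N}`. -/
abbrev TotalIndex (n : Fin N → ℕ) : Type := Σ k, Fin (n k)

/-- `F(W) = D + C (P(W) ⊗ I) (I - A (P(W) ⊗ I))⁻¹ B` on the product of disks, with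
`T = [A B; C D]` and `P(W) = diag(W_1, …, W_N)`. -/
def IsRealization {X : Type*} [NormedAddCommGroup X] [InnerProductSpace ℂ X]
    (F : Tuple n → U →L[ℂ] U)
    (T : WithLp 2 (Tensor (TotalIndex n) X × U) →L[ℂ] WithLp 2 (Tensor (TotalIndex n) X × U)) :
    Prop :=
  ∀ W ∈ disk n, IsUnit (1 - block11 T ∘L ampl (Matrix.blockDiagonal' W)) ∧
    F W = block22 T + block21 T ∘L ampl (Matrix.blockDiagonal' W) ∘L
      Ring.inverse (1 - block11 T ∘L ampl (Matrix.blockDiagonal' W)) ∘L block12 T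

end Representations

/-! ### The Bessmertnyĭ class -/

/-- `f` belongs to the class `B_{n_1,…,n_N}(U)`: it is holomorphic on `Ω` and has a long
resolvent representation there. -/
def MemBessmertnyi {N : ℕ} (n : Fin N → ℕ) (U : Type u) [NormedAddCommGroup U]
    [InnerProductSpace ℂ U] [CompleteSpace U] (f : Tuple n → U →L[ℂ] U) : Prop :=
  DifferentiableOn ℂ f (Omega n) ∧
  ∃ (H : Type u) (_ : NormedAddCommGroup H) (_ : InnerProductSpace ℂ H) (_ : CompleteSpace H)
    (M : Fin N → Type u) (_ : ∀ k, NormedAddCommGroup (M k))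
    (_ : ∀ k, InnerProductSpace ℂ (M k)) (_ : ∀ k, CompleteSpace (M k))
    (G : ∀ k, WithLp 2 (U × H) →L[ℂ] Tensor (Fin (n k)) (M k)),
    IsLongResolvent f G

end

end Bessmertnyi

/-! Everything rests on reading a Schur complement as a linear system: `f(Z)` is the Schur
complement of `A(Z)` exactly when for every `u` some `h` gives `A(Z)(u,h) = (f(Z)u, 0)`, and
invertibility of `d(Z)` makes `h` unique (`eq_schurComplement_iff`). Reality statements then become
uniqueness statements.

(i) ⇒ (ii): choose arbitrary AUIs on `H` and `M_k` and conjugate the `G_k` by them. As `f` is real,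
the conjugated family represents `f` too (`IsLongResolvent.conjOp`). Glue both along `U`, scaled by
`1/√2`: the pencils are averaged, the Schur complement is `(f + f)/2`, and the AUI that swaps the
two copies makes the glued operators real (`IsLongResolvent.double`, `isRealOp_doubleOp`). The
converse is uniqueness of `h`.

(ii) ⇒ (iii): apply `G_k` to the solution `(u,h)`.

(iii) ⇒ (iv): gather the `φ_k` into one `φ`, so that `f(Z) = φ(Y)^* (Z ⊗ I) φ(Z)`. This says that
the vectors `(Zφ(Z)x, f(Z)x)` are orthogonal to the vectors `(-φ(Y)y, y)`. Reflection in the closed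
span of the former is a self-adjoint unitary, and the Cayley transform turns sums and differences of
such vectors into the input and output of a realization of `C(f)`
(`IsDiagDecomposition.reflectionL_apply`).

(iv) ⇒ (ii): run this backwards. The eigenvectors of `T` for `1` and `-1` produce `φ`, and their
orthogonality is the decomposition (`IsRealization.exists_isDiagDecomposition`). Compressing `Z ⊗ I`
to `φ(I)U` plus the closed span of the differences `φ(Z)x - φ(I)x` gives a long resolvent on the
halfplanes, where `d` is coercive. It extends to `Omega` because `f` is homogeneous: for positive
scalars by the pencil, for complex ones by the identity theorem. -/

namespace Bessmertnyi

noncomputable section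

/-! ### Anti-unitary involutions. -/

section AUILemmas

variable {E F : Type*} [NormedAddCommGroup E] [InnerProductSpace ℂ E]
  [NormedAddCommGroup F] [InnerProductSpace ℂ F]

theorem AUI.map_zero (ι : AUI E) : ι 0 = 0 := by
  simpa using ι.map_smul 0 0

theorem AUI.map_neg (ι : AUI E) (x : E) : ι (-x) = -ι x := by
  simpa using ι.map_smul (-1) x

theorem AUI.map_sub (ι : AUI E) (x y : E) : ι (x - y) = ι x - ι y := by
  rw [sub_eq_add_neg, ι.map_add, ι.map_neg, sub_eq_add_neg]

theorem AUI.map_sum (ι : AUI E) {α : Type*} (s : Finset α) (g : α → E) :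
    ι (∑ i ∈ s, g i) = ∑ i ∈ s, ι (g i) := by
  classical
  induction s using Finset.induction_on with
  | empty => simp [ι.map_zero]
  | insert a s ha ih => rw [Finset.sum_insert ha, Finset.sum_insert ha, ι.map_add, ih]

theorem AUI.norm_map (ι : AUI E) (x : E) : ‖ι x‖ = ‖x‖ := by
  rw [norm_eq_sqrt_re_inner (𝕜 := ℂ), norm_eq_sqrt_re_inner (𝕜 := ℂ), ι.inner_map]

theorem AUI.isometry (ι : AUI E) : Isometry ι :=
  Isometry.of_dist_eq fun x y => by rw [dist_eq_norm, dist_eq_norm, ← ι.map_sub, ι.norm_map]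

theorem AUI.bijective (ι : AUI E) : Function.Bijective ι :=
  Function.Involutive.bijective ι.invol

theorem AUI.prod_fst (ι : AUI E) (κ : AUI F) (x : WithLp 2 (E × F)) :
    (ι.prod κ x).fst = ι x.fst := rfl

theorem AUI.prod_snd (ι : AUI E) (κ : AUI F) (x : WithLp 2 (E × F)) :
    (ι.prod κ x).snd = κ x.snd := rfl

theorem AUI.prod_toLp (ι : AUI E) (κ : AUI F) (x : E) (y : F) :
    ι.prod κ (WithLp.toLp 2 (x, y)) = WithLp.toLp 2 (ι x, κ y) := rfl

theorem AUI.tensor_apply {s : Type*} [Fintype s] (ι : AUI E) (x : Tensor s E) (i : s) :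
    AUI.tensor s ι x i = ι (x i) := rfl

/-- The operator `κ A ι` obtained from `A` by conjugation with anti-unitary involutions. -/
def AUI.conjOp (ι : AUI E) (κ : AUI F) (A : E →L[ℂ] F) : E →L[ℂ] F :=
  LinearMap.mkContinuous
    { toFun := fun x => κ (A (ι x))
      map_add' := fun x y => by rw [ι.map_add, _root_.map_add, κ.map_add]
      map_smul' := fun c x => by rw [ι.map_smul, _root_.map_smul, κ.map_smul]; simp } ‖A‖
    fun x => by
      change ‖κ (A (ι x))‖ ≤ _
      rw [κ.norm_map, ← ι.norm_map x]
      exact A.le_opNorm _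

theorem AUI.conjOp_apply (ι : AUI E) (κ : AUI F) (A : E →L[ℂ] F) (x : E) :
    ι.conjOp κ A x = κ (A (ι x)) := rfl

/-- The restriction of an anti-unitary involution to an invariant subspace. -/
def AUI.restrict (ι : AUI E) (S : Submodule ℂ E) (hS : ∀ x ∈ S, ι x ∈ S) : AUI S where
  toFun x := ⟨ι x, hS x x.2⟩
  invol x := Subtype.ext (ι.invol x)
  inner_map x y := ι.inner_map x y

/-- The anti-unitary involution `(x, y) ↦ (ι y, ι x)` on `E ⊕ E`. -/
def AUI.swap (ι : AUI E) : AUI (WithLp 2 (E × E)) where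
  toFun x := WithLp.toLp 2 (ι x.snd, ι x.fst)
  invol x := by
    apply (WithLp.equiv 2 (E × E)).injective
    simp [ι.invol]
    rfl
  inner_map x y := by
    simp [WithLp.prod_inner_apply, ι.inner_map, add_comm]

/-- Every Hilbert space carries an anti-unitary involution. -/
theorem AUI.nonempty (E : Type*) [NormedAddCommGroup E] [InnerProductSpace ℂ E]
    [CompleteSpace E] : Nonempty (AUI E) := by
  obtain ⟨w, b, -⟩ := exists_hilbertBasis ℂ E
  -- Coordinatewise conjugation in a Hilbert basis.
  refine ⟨⟨fun x => b.repr.symm (star (b.repr x)), fun x => by simp, fun x y => ?_⟩⟩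
  rw [← b.repr.inner_map_map, LinearIsometryEquiv.apply_symm_apply,
    LinearIsometryEquiv.apply_symm_apply, ← b.repr.inner_map_map y x, lp.inner_eq_tsum,
    lp.inner_eq_tsum]
  refine tsum_congr fun i => ?_
  simp [lp.star_apply, mul_comm]

/-- The closed span of a set that is invariant under an anti-unitary involution is invariant. -/
theorem AUI.mem_closure_span (ι : AUI E) {s : Set E} (hs : ∀ x ∈ s, ι x ∈ s) {x : E}
    (hx : x ∈ (Submodule.span ℂ s).topologicalClosure) :
    ι x ∈ (Submodule.span ℂ s).topologicalClosure := by
  have hspan : ∀ y ∈ Submodule.span ℂ s, ι y ∈ Submodule.span ℂ s := by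
    intro y hy
    induction hy using Submodule.span_induction with
    | mem y hy => exact Submodule.subset_span (hs y hy)
    | zero => rw [ι.map_zero]; exact Submodule.zero_mem _
    | add y z _ _ hy hz => rw [ι.map_add]; exact Submodule.add_mem _ hy hz
    | smul c y _ hy => rw [ι.map_smul]; exact Submodule.smul_mem _ _ hy
  exact map_mem_closure ι.isometry.continuous hx hspan

end AUILemmas

/-! ### The operators `Z ⊗ I`: adjoints, coercivity, contractivity. -/

section AmplLemmas

variable {s : Type*} [Fintype s] {E : Type*} [NormedAddCommGroup E] [InnerProductSpace ℂ E]

theorem ampl_add (Z Y : Matrix s s ℂ) :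
    (ampl (Z + Y) : Tensor s E →L[ℂ] Tensor s E) = ampl Z + ampl Y := by
  ext x i
  simp [ampl_apply, add_smul, Finset.sum_add_distrib]

theorem ampl_smul (c : ℂ) (Z : Matrix s s ℂ) :
    (ampl (c • Z) : Tensor s E →L[ℂ] Tensor s E) = c • ampl Z := by
  ext x i
  simp [ampl_apply, smul_smul, Finset.smul_sum]

theorem ampl_sub (Z Y : Matrix s s ℂ) :
    (ampl (Z - Y) : Tensor s E →L[ℂ] Tensor s E) = ampl Z - ampl Y := by
  ext x i
  simp [ampl_apply, sub_smul, Finset.sum_sub_distrib]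

theorem ampl_one [DecidableEq s] :
    (ampl (1 : Matrix s s ℂ) : Tensor s E →L[ℂ] Tensor s E) = 1 := by
  ext x i
  simp [ampl_apply, Matrix.one_apply]

theorem ampl_mul_apply (Z Y : Matrix s s ℂ) (x : Tensor s E) :
    ampl (Z * Y) x = ampl Z (ampl Y x) := by
  ext i
  simp only [ampl_apply, Matrix.mul_apply, Finset.sum_smul, Finset.smul_sum, smul_smul]
  exact Finset.sum_comm

theorem inner_ampl_left (Z : Matrix s s ℂ) (x y : Tensor s E) :
    inner ℂ (ampl Z x) y = inner ℂ x (ampl Zᴴ y) := by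
  simp only [PiLp.inner_apply, ampl_apply, sum_inner, inner_sum, inner_smul_left,
    inner_smul_right, Matrix.conjTranspose_apply]
  exact Finset.sum_comm

theorem adjoint_ampl [CompleteSpace E] (Z : Matrix s s ℂ) :
    ContinuousLinearMap.adjoint (ampl Z : Tensor s E →L[ℂ] Tensor s E) = ampl Zᴴ := by
  symm
  rw [ContinuousLinearMap.eq_adjoint_iff]
  intro x y
  rw [inner_ampl_left, Matrix.conjTranspose_conjTranspose]

theorem AUI.tensor_ampl (ι : AUI E) (Z : Matrix s s ℂ) (x : Tensor s E) :
    AUI.tensor s ι (ampl Z x) = ampl (Z.map (starRingEnd ℂ)) (AUI.tensor s ι x) := by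
  ext i
  simp only [AUI.tensor_apply, ampl_apply, ι.map_sum, ι.map_smul, Matrix.map_apply]

-- An invertible factor `B` carries positivity from matrices to amplifications with no eigenvalue
-- argument: `ampl B⁻¹` bounds `‖x‖` by `‖ampl B x‖`.
open scoped MatrixOrder in
theorem exists_isUnit_eq_conjTranspose_mul_self [DecidableEq s] {M : Matrix s s ℂ}
    (hM : M.PosDef) : ∃ B : Matrix s s ℂ, IsUnit B ∧ M = Bᴴ * B := by
  obtain ⟨B, hB⟩ := CStarAlgebra.nonneg_iff_eq_star_mul_self.mp hM.posSemidef.nonneg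
  refine ⟨B, ?_, hB⟩
  have h := hM.isUnit
  rw [hB, Matrix.isUnit_iff_isUnit_det, Matrix.det_mul] at h
  exact (Matrix.isUnit_iff_isUnit_det _).2 (isUnit_of_mul_isUnit_right h)

theorem posDef_blockDiagonal' {N : ℕ} {n : Fin N → ℕ} {M : Tuple n} (hM : ∀ k, (M k).PosDef) :
    (Matrix.blockDiagonal' M).PosDef := by
  choose B hB hMB using fun k => exists_isUnit_eq_conjTranspose_mul_self (hM k)
  have h : Matrix.blockDiagonal' M = (Matrix.blockDiagonal' B)ᴴ * Matrix.blockDiagonal' B := by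
    rw [Matrix.blockDiagonal'_conjTranspose, ← Matrix.blockDiagonal'_mul]
    congr 1
    exact funext hMB
  have hu : IsUnit (Matrix.blockDiagonal' B) :=
    (Pi.isUnit_iff.2 hB).map (Matrix.blockDiagonal'RingHom (fun k => Fin (n k)) ℂ)
  rw [h]
  refine (Matrix.PosSemidef.posDef_iff_isUnit
    (Matrix.posSemidef_conjTranspose_mul_self _)).2 ?_
  exact (hu.star).mul hu

theorem exists_le_re_inner_ampl [DecidableEq s] {M : Matrix s s ℂ} (hM : M.PosDef) :
    ∃ ε : ℝ, 0 < ε ∧ ∀ x : Tensor s E, ε * ‖x‖ ^ 2 ≤ (inner ℂ (ampl M x) x).re := by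
  obtain ⟨B, hB, rfl⟩ := exists_isUnit_eq_conjTranspose_mul_self hM
  set C : Tensor s E →L[ℂ] Tensor s E := ampl B⁻¹
  -- The `+ 1` keeps the constant positive when the space is trivial and `C = 0`.
  refine ⟨((‖C‖ + 1) ^ 2)⁻¹, by positivity, fun x => ?_⟩
  have hx : C (ampl B x) = x := by
    rw [← ampl_mul_apply, Matrix.nonsing_inv_mul _ ((Matrix.isUnit_iff_isUnit_det _).1 hB),
      ampl_one]
    rfl
  have h1 : ‖x‖ ≤ (‖C‖ + 1) * ‖ampl B x‖ := by
    calc ‖x‖ = ‖C (ampl B x)‖ := by rw [hx]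
      _ ≤ ‖C‖ * ‖ampl B x‖ := C.le_opNorm _
      _ ≤ _ := by gcongr; linarith
  have h2 : (inner ℂ (ampl (Bᴴ * B) x) x).re = ‖ampl B x‖ ^ 2 := by
    rw [ampl_mul_apply, inner_ampl_left, Matrix.conjTranspose_conjTranspose]
    exact inner_self_eq_norm_sq (𝕜 := ℂ) _
  rw [h2, inv_mul_le_iff₀ (by positivity), ← mul_pow]
  gcongr

theorem exists_le_re_inner_ampl_of_add_conjTranspose [DecidableEq s] {Z : Matrix s s ℂ}
    (hZ : (Z + Zᴴ).PosDef) :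
    ∃ ε : ℝ, 0 < ε ∧ ∀ x : Tensor s E, ε * ‖x‖ ^ 2 ≤ (inner ℂ (ampl Z x) x).re := by
  obtain ⟨ε, hε, h⟩ := exists_le_re_inner_ampl (E := E) hZ
  refine ⟨ε / 2, by positivity, fun x => ?_⟩
  have h1 := h x
  have h2 : (inner ℂ (ampl Zᴴ x) x).re = (inner ℂ (ampl Z x) x).re := by
    rw [inner_ampl_left, Matrix.conjTranspose_conjTranspose]
    exact inner_re_symm (𝕜 := ℂ) _ _
  rw [ampl_add, _root_.add_apply, inner_add_left, Complex.add_re, h2] at h1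
  linarith

/-- If `W W^* < I`, then `W ⊗ I` is a strict contraction. -/
theorem norm_ampl_lt_one [DecidableEq s] [CompleteSpace E] {W : Matrix s s ℂ}
    (hW : (1 - W * Wᴴ).PosDef) : ‖(ampl W : Tensor s E →L[ℂ] Tensor s E)‖ < 1 := by
  obtain ⟨ε, hε, h⟩ := exists_le_re_inner_ampl (E := E) hW
  -- The hypothesis involves `W W^*`, so it bounds the adjoint; the norm is the same.
  have h1 : ∀ x : Tensor s E, ‖ampl Wᴴ x‖ ^ 2 ≤ (1 - ε) * ‖x‖ ^ 2 := by
    intro x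
    have h2 := h x
    have h3 : (inner ℂ (ampl (W * Wᴴ) x) x).re = ‖ampl Wᴴ x‖ ^ 2 := by
      rw [ampl_mul_apply, inner_ampl_left]
      exact inner_self_eq_norm_sq (𝕜 := ℂ) _
    have h4 : (inner ℂ x x).re = ‖x‖ ^ 2 := inner_self_eq_norm_sq (𝕜 := ℂ) _
    rw [ampl_sub, ampl_one, _root_.sub_apply, inner_sub_left, Complex.sub_re, h3,
      one_apply_eq_self, h4] at h2
    linarith
  -- On a trivial space `1 - ε` may be negative, hence the maximum.
  have hr : 0 ≤ max (1 - ε) 0 := le_max_right _ _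
  have h5 : ‖(ampl Wᴴ : Tensor s E →L[ℂ] Tensor s E)‖ ≤ Real.sqrt (max (1 - ε) 0) := by
    refine ContinuousLinearMap.opNorm_le_bound _ (Real.sqrt_nonneg _) fun x => ?_
    refine le_of_sq_le_sq ?_ (by positivity)
    rw [mul_pow, Real.sq_sqrt hr]
    exact (h1 x).trans (by gcongr; exact le_max_left _ _)
  have h6 : ‖(ampl W : Tensor s E →L[ℂ] Tensor s E)‖ =
      ‖(ampl Wᴴ : Tensor s E →L[ℂ] Tensor s E)‖ := by
    rw [← adjoint_ampl]
    exact (LinearIsometryEquiv.norm_map ContinuousLinearMap.adjoint _).symm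
  rw [h6]
  refine h5.trans_lt ?_
  rw [Real.sqrt_lt' one_pos]
  simp [hε]

end AmplLemmas

/-! ### The Cayley transform of a single matrix. -/

section MatrixLemmas

theorem posDef_two_smul_iff {s : Type*} {M : Matrix s s ℂ} : ((2 : ℂ) • M).PosDef ↔ M.PosDef := by
  refine ⟨fun h => ?_, fun h => h.smul (by norm_num)⟩
  have h1 := h.smul (a := (2 : ℂ)⁻¹) (by norm_num)
  rwa [smul_smul, inv_mul_cancel₀ two_ne_zero, one_smul] at h1

variable {s : Type*} [Fintype s] [DecidableEq s]

/-- A kernel vector `v` of `A` would satisfy `v^* (A + A^*) v = 0`. -/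
theorem isUnit_of_posDef_add_conjTranspose {A : Matrix s s ℂ} (hA : (A + Aᴴ).PosDef) :
    IsUnit A := by
  rw [← Matrix.mulVec_injective_iff_isUnit]
  have h : ∀ v, A *ᵥ v = 0 → v = 0 := by
    intro v hv
    by_contra hne
    have h1 := hA.dotProduct_mulVec_pos hne
    rw [Matrix.add_mulVec, dotProduct_add, hv, Matrix.dotProduct_mulVec, ← Matrix.star_mulVec,
      hv] at h1
    simp at h1
  intro v w hvw
  exact sub_eq_zero.1 (h _ (by rw [Matrix.mulVec_sub]; exact sub_eq_zero.2 hvw))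

theorem isUnit_one_sub_of_posDef {W : Matrix s s ℂ} (hW : (1 - W * Wᴴ).PosDef) :
    IsUnit (1 - W) := by
  apply isUnit_of_posDef_add_conjTranspose
  have h : 1 - W + (1 - W)ᴴ = (1 - W * Wᴴ) + (1 - W) * (1 - W)ᴴ := by
    simp only [Matrix.conjTranspose_sub, Matrix.conjTranspose_one]
    noncomm_ring
  rw [h]
  exact hW.add_posSemidef (Matrix.posSemidef_self_mul_conjTranspose _)

theorem isUnit_add_one_of_posDef {Z : Matrix s s ℂ} (hZ : (Z + Zᴴ).PosDef) :
    IsUnit (Z + 1) := by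
  apply isUnit_of_posDef_add_conjTranspose
  have h : Z + 1 + (Z + 1)ᴴ = (Z + Zᴴ) + (1 + 1) := by
    simp only [Matrix.conjTranspose_add, Matrix.conjTranspose_one]
    abel
  rw [h]
  exact hZ.add (Matrix.PosDef.one.add Matrix.PosDef.one)

/-- Congruence by `1 - W` turns `Z + Z^*` into `2 (1 - W W^*)`. In the inverse direction, congruence
by `Z + 1` does the reverse. -/
theorem posDef_cayley {W : Matrix s s ℂ} (hW : (1 - W * Wᴴ).PosDef) :
    ((1 + W) * (1 - W)⁻¹ + ((1 + W) * (1 - W)⁻¹)ᴴ).PosDef := by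
  have hu := isUnit_one_sub_of_posDef hW
  have hd := (Matrix.isUnit_iff_isUnit_det _).1 hu
  set Z := (1 + W) * (1 - W)⁻¹ with hZ
  have h1 : (1 - W) * Z = 1 + W := by
    rw [hZ, ← mul_assoc, show (1 - W) * (1 + W) = (1 + W) * (1 - W) by noncomm_ring, mul_assoc,
      Matrix.mul_nonsing_inv _ hd, mul_one]
  rw [← Matrix.IsUnit.posDef_star_right_conjugate_iff hu]
  have h2 : (1 - W) * (Z + Zᴴ) * star (1 - W) = (2 : ℂ) • (1 - W * Wᴴ) := by
    calc (1 - W) * (Z + Zᴴ) * star (1 - W)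
        = ((1 - W) * Z) * (1 - W)ᴴ + (1 - W) * ((1 - W) * Z)ᴴ := by
          rw [Matrix.star_eq_conjTranspose, Matrix.conjTranspose_mul (1 - W) Z]
          noncomm_ring
      _ = _ := by
          rw [h1, two_smul]
          simp only [Matrix.conjTranspose_sub, Matrix.conjTranspose_add, Matrix.conjTranspose_one]
          noncomm_ring
  rw [h2, posDef_two_smul_iff]
  exact hW

theorem posDef_cayley_inverse {Z : Matrix s s ℂ} (hZ : (Z + Zᴴ).PosDef) :
    (1 - ((Z - 1) * (Z + 1)⁻¹) * ((Z - 1) * (Z + 1)⁻¹)ᴴ).PosDef := by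
  have hu := isUnit_add_one_of_posDef hZ
  have hd := (Matrix.isUnit_iff_isUnit_det _).1 hu
  set W := (Z - 1) * (Z + 1)⁻¹ with hW
  have h1 : (Z + 1) * W = Z - 1 := by
    rw [hW, ← mul_assoc, show (Z + 1) * (Z - 1) = (Z - 1) * (Z + 1) by noncomm_ring, mul_assoc,
      Matrix.mul_nonsing_inv _ hd, mul_one]
  rw [← Matrix.IsUnit.posDef_star_right_conjugate_iff hu]
  have h2 : (Z + 1) * (1 - W * Wᴴ) * star (Z + 1) = (2 : ℂ) • (Z + Zᴴ) := by
    calc (Z + 1) * (1 - W * Wᴴ) * star (Z + 1)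
        = (Z + 1) * (Z + 1)ᴴ - ((Z + 1) * W) * ((Z + 1) * W)ᴴ := by
          rw [Matrix.star_eq_conjTranspose, Matrix.conjTranspose_mul (Z + 1) W]
          noncomm_ring
      _ = _ := by
          rw [h1, two_smul]
          simp only [Matrix.conjTranspose_sub, Matrix.conjTranspose_add, Matrix.conjTranspose_one]
          noncomm_ring
  rw [h2, posDef_two_smul_iff]
  exact hZ

theorem cayley_cayley_inverse {Z : Matrix s s ℂ} (hZ : (Z + Zᴴ).PosDef) :
    (1 + (Z - 1) * (Z + 1)⁻¹) * (1 - (Z - 1) * (Z + 1)⁻¹)⁻¹ = Z := by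
  have hu := isUnit_add_one_of_posDef hZ
  have hd := (Matrix.isUnit_iff_isUnit_det _).1 hu
  have hd' := (Matrix.isUnit_iff_isUnit_det _).1
    (isUnit_one_sub_of_posDef (posDef_cayley_inverse hZ))
  set W := (Z - 1) * (Z + 1)⁻¹ with hW
  have h1 : W * (Z + 1) = Z - 1 := by
    rw [hW, mul_assoc, Matrix.nonsing_inv_mul _ hd, mul_one]
  clear_value W
  have h2 : 1 + W = Z * (1 - W) := by
    refine hu.mul_right_cancel ?_
    rw [add_mul, mul_assoc, sub_mul 1 W, h1]
    noncomm_ring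
  rw [h2, mul_assoc, Matrix.mul_nonsing_inv _ hd', mul_one]

end MatrixLemmas

/-! ### Halfplanes, their rotations, and disks. -/

section DomainLemmas

variable {N : ℕ} {n : Fin N → ℕ}

theorem halfplane_subset_Omega : halfplane n ⊆ Omega n :=
  fun Z hZ => ⟨1, by simp, Z, hZ, by simp⟩

theorem one_mem_halfplane : (1 : Tuple n) ∈ halfplane n := fun k => by
  rw [Pi.one_apply, Matrix.conjTranspose_one]
  exact Matrix.PosDef.one.add Matrix.PosDef.one

theorem smul_mem_halfplane {r : ℝ} (hr : 0 < r) {Z : Tuple n} (hZ : Z ∈ halfplane n) :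
    (r : ℂ) • Z ∈ halfplane n := fun k => by
  have h := (hZ k).smul (a := (r : ℂ)) (by exact_mod_cast hr)
  rw [Pi.smul_apply, Matrix.conjTranspose_smul]
  simpa [smul_add] using h

/-- Makes `w ↦ f(e^w Z)` an entire function, to which the identity theorem will apply. -/
theorem exp_smul_mem_Omega {Z : Tuple n} (hZ : Z ∈ halfplane n) (w : ℂ) :
    Complex.exp w • Z ∈ Omega n := by
  refine ⟨Complex.exp (w.im * Complex.I), Complex.norm_exp_ofReal_mul_I _,
    (Real.exp w.re : ℂ) • Z, smul_mem_halfplane (Real.exp_pos _) hZ, ?_⟩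
  rw [smul_smul, Complex.ofReal_exp, ← Complex.exp_add, add_comm, Complex.re_add_im]

theorem conjTuple_conjTuple (Z : Tuple n) : conjTuple (conjTuple Z) = Z := by
  ext k i j
  simp [conjTuple]

theorem conjTuple_one : conjTuple (1 : Tuple n) = 1 := by
  ext k i j
  simp [conjTuple, Matrix.one_apply, apply_ite]

theorem conjTuple_smul (c : ℂ) (Z : Tuple n) :
    conjTuple (c • Z) = starRingEnd ℂ c • conjTuple Z := by
  ext k i j
  simp [conjTuple]

theorem conjTuple_mem_halfplane {Z : Tuple n} (hZ : Z ∈ halfplane n) :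
    conjTuple Z ∈ halfplane n := fun k => by
  have h : conjTuple Z k + (conjTuple Z k)ᴴ = (Z k + (Z k)ᴴ)ᵀ := by
    ext i j
    simp [conjTuple, add_comm]
  rw [h]
  exact (hZ k).transpose

theorem conjTuple_mem_Omega {Z : Tuple n} (hZ : Z ∈ Omega n) : conjTuple Z ∈ Omega n := by
  obtain ⟨c, hc, Y, hY, rfl⟩ := hZ
  exact ⟨starRingEnd ℂ c, by simpa using hc, conjTuple Y, conjTuple_mem_halfplane hY,
    conjTuple_smul c Y⟩

theorem blockDiagonal'_conjTuple (Z : Tuple n) :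
    Matrix.blockDiagonal' (conjTuple Z) = (Matrix.blockDiagonal' Z).map (starRingEnd ℂ) :=
  (Matrix.blockDiagonal'_map Z _ (_root_.map_zero _)).symm

theorem posDef_blockDiagonal'_add {Z : Tuple n} (hZ : Z ∈ halfplane n) :
    (Matrix.blockDiagonal' Z + (Matrix.blockDiagonal' Z)ᴴ).PosDef := by
  rw [Matrix.blockDiagonal'_conjTranspose, ← Matrix.blockDiagonal'_add]
  exact posDef_blockDiagonal' hZ

theorem posDef_one_sub_blockDiagonal' {W : Tuple n} (hW : W ∈ disk n) :
    (1 - Matrix.blockDiagonal' W * (Matrix.blockDiagonal' W)ᴴ).PosDef := by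
  rw [Matrix.blockDiagonal'_conjTranspose, ← Matrix.blockDiagonal'_mul,
    ← Matrix.blockDiagonal'_one, ← Matrix.blockDiagonal'_sub]
  exact posDef_blockDiagonal' hW

theorem cayley_mem_halfplane {W : Tuple n} (hW : W ∈ disk n) : cayley W ∈ halfplane n :=
  fun k => posDef_cayley (hW k)

theorem exists_disk_cayley_eq {Z : Tuple n} (hZ : Z ∈ halfplane n) :
    ∃ W ∈ disk n, cayley W = Z :=
  ⟨fun k => (Z k - 1) * (Z k + 1)⁻¹, fun k => posDef_cayley_inverse (hZ k),
    funext fun k => cayley_cayley_inverse (hZ k)⟩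

theorem blockDiagonal'_cayley_mul {W : Tuple n} (hW : W ∈ disk n) :
    Matrix.blockDiagonal' (cayley W) * (1 - Matrix.blockDiagonal' W) =
      1 + Matrix.blockDiagonal' W := by
  rw [← Matrix.blockDiagonal'_one, ← Matrix.blockDiagonal'_sub, ← Matrix.blockDiagonal'_add,
    ← Matrix.blockDiagonal'_mul]
  congr 1
  funext k
  have hd := (Matrix.isUnit_iff_isUnit_det _).1 (isUnit_one_sub_of_posDef (hW k))
  change (1 + W k) * (1 - W k)⁻¹ * (1 - W k) = 1 + W k
  rw [mul_assoc, Matrix.nonsing_inv_mul _ hd, mul_one]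

end DomainLemmas

/-! ### Schur complements as solutions of linear systems. -/

section SchurComplement

variable {E F : Type*} [NormedAddCommGroup E] [InnerProductSpace ℂ E]
  [NormedAddCommGroup F] [InnerProductSpace ℂ F]

theorem inverse_apply_apply {T : E →L[ℂ] E} (hT : IsUnit T) (x : E) :
    Ring.inverse T (T x) = x :=
  congrArg (fun S : E →L[ℂ] E => S x) (Ring.inverse_mul_cancel T hT)

theorem apply_inverse_apply {T : E →L[ℂ] E} (hT : IsUnit T) (x : E) :
    T (Ring.inverse T x) = x :=
  congrArg (fun S : E →L[ℂ] E => S x) (Ring.mul_inverse_cancel T hT)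

theorem toLp_eq_inlL_add_inrL (x : E) (y : F) :
    WithLp.toLp 2 (x, y) = inlL E F x + inrL E F y := by
  simp [inlL, inrL, ← WithLp.toLp_add]

theorem fst_apply_toLp (T : WithLp 2 (E × F) →L[ℂ] WithLp 2 (E × F)) (x : E) (y : F) :
    (T (WithLp.toLp 2 (x, y))).fst = block11 T x + block12 T y := by
  rw [toLp_eq_inlL_add_inrL, map_add]
  rfl

theorem snd_apply_toLp (T : WithLp 2 (E × F) →L[ℂ] WithLp 2 (E × F)) (x : E) (y : F) :
    (T (WithLp.toLp 2 (x, y))).snd = block21 T x + block22 T y := by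
  rw [toLp_eq_inlL_add_inrL, map_add]
  rfl

theorem eq_neg_inverse_of_snd_eq_zero {T : WithLp 2 (E × F) →L[ℂ] WithLp 2 (E × F)}
    (hT : IsUnit (block22 T)) {x : E} {y : F} (h : (T (WithLp.toLp 2 (x, y))).snd = 0) :
    y = -Ring.inverse (block22 T) (block21 T x) := by
  rw [snd_apply_toLp, add_comm] at h
  rw [← inverse_apply_apply hT y, eq_neg_of_add_eq_zero_left h, map_neg]

theorem snd_apply_neg_inverse {T : WithLp 2 (E × F) →L[ℂ] WithLp 2 (E × F)}
    (hT : IsUnit (block22 T)) (x : E) :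
    (T (WithLp.toLp 2 (x, -Ring.inverse (block22 T) (block21 T x)))).snd = 0 := by
  rw [snd_apply_toLp, map_neg, apply_inverse_apply hT, add_neg_cancel]

/-- The Schur complement `g = a - b d⁻¹ c` is characterised by `T (x, y) = (g x, 0)`. -/
theorem eq_schurComplement_iff {T : WithLp 2 (E × F) →L[ℂ] WithLp 2 (E × F)}
    (hT : IsUnit (block22 T)) (g : E →L[ℂ] E) :
    g = block11 T - block12 T ∘L Ring.inverse (block22 T) ∘L block21 T ↔
      ∀ x, ∃ y, T (WithLp.toLp 2 (x, y)) = WithLp.toLp 2 (g x, 0) := by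
  constructor
  · rintro rfl x
    refine ⟨-Ring.inverse (block22 T) (block21 T x), ?_⟩
    apply (WithLp.equiv 2 (E × F)).injective
    refine Prod.ext ?_ (snd_apply_neg_inverse hT x)
    refine (fst_apply_toLp _ _ _).trans ?_
    simp [sub_eq_add_neg]
  · intro h
    ext x
    obtain ⟨y, hy⟩ := h x
    have h2 := eq_neg_inverse_of_snd_eq_zero hT (by rw [hy, WithLp.toLp_snd])
    have h1 := fst_apply_toLp T x y
    rw [hy, WithLp.toLp_fst, h2] at h1
    refine h1.trans ?_
    simp [sub_eq_add_neg]

theorem differentiableAt_schurColumn [CompleteSpace F] {V : Type*} [NormedAddCommGroup V]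
    [NormedSpace ℂ V] {T : V → WithLp 2 (E × F) →L[ℂ] WithLp 2 (E × F)} {z : V}
    (hT : DifferentiableAt ℂ T z) (hu : IsUnit (block22 (T z))) :
    DifferentiableAt ℂ (fun v => inlL E F -
      inrL E F ∘L Ring.inverse (block22 (T v)) ∘L block21 (T v)) z := by
  have h22 : DifferentiableAt ℂ (fun v => block22 (T v)) z := by
    unfold block22; fun_prop
  have h21 : DifferentiableAt ℂ (fun v => block21 (T v)) z := by
    unfold block21; fun_prop
  have hinv : DifferentiableAt ℂ (fun v => Ring.inverse (block22 (T v))) z :=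
    DifferentiableAt.comp (g := Ring.inverse) z (differentiableAt_inverse hu) h22
  have h : DifferentiableAt ℂ
      (fun v => inrL E F ∘L Ring.inverse (block22 (T v)) ∘L block21 (T v)) z :=
    (differentiableAt_const (inrL E F)).clm_comp (hinv.clm_comp h21)
  exact DifferentiableAt.const_sub (𝕜 := ℂ) (E := V) (F := E →L[ℂ] WithLp 2 (E × F)) h _

end SchurComplement

/-! ### Pencils, and the passage from long resolvents to decompositions. -/

section Pencil

variable {N : ℕ} {n : Fin N → ℕ}
  {U : Type*} [NormedAddCommGroup U] [InnerProductSpace ℂ U] [CompleteSpace U]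
  {H : Type*} [NormedAddCommGroup H] [InnerProductSpace ℂ H] [CompleteSpace H]
  {M : Fin N → Type*} [∀ k, NormedAddCommGroup (M k)] [∀ k, InnerProductSpace ℂ (M k)]
  [∀ k, CompleteSpace (M k)]

theorem isLongResolvent_iff {f : Tuple n → U →L[ℂ] U}
    {G : ∀ k, WithLp 2 (U × H) →L[ℂ] Tensor (Fin (n k)) (M k)} :
    IsLongResolvent f G ↔ ∀ Z ∈ Omega n, IsUnit (block22 (pencil G Z)) ∧
      ∀ u, ∃ h, pencil G Z (WithLp.toLp 2 (u, h)) = WithLp.toLp 2 (f Z u, 0) :=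
  forall₂_congr fun _ _ => and_congr_right fun hd => eq_schurComplement_iff hd _

theorem inner_pencil_left (G : ∀ k, WithLp 2 (U × H) →L[ℂ] Tensor (Fin (n k)) (M k))
    (Z : Tuple n) (x y : WithLp 2 (U × H)) :
    inner ℂ (pencil G Z x) y = ∑ k, inner ℂ (ampl (Z k) (G k x)) (G k y) := by
  simp [pencil, ContinuousLinearMap.adjoint_inner_left]

theorem pencil_smul (G : ∀ k, WithLp 2 (U × H) →L[ℂ] Tensor (Fin (n k)) (M k))
    (c : ℂ) (Z : Tuple n) : pencil G (c • Z) = c • pencil G Z := by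
  simp [pencil, ampl_smul, Finset.smul_sum]

theorem pencil_add (G : ∀ k, WithLp 2 (U × H) →L[ℂ] Tensor (Fin (n k)) (M k))
    (Z Y : Tuple n) : pencil G (Z + Y) = pencil G Z + pencil G Y := by
  simp [pencil, ampl_add, Finset.sum_add_distrib]

/-- Allowing `G'` to differ from `G` serves both uses: real families (`G' = G`) and conjugated ones.
-/
theorem pencil_conjTuple {G G' : ∀ k, WithLp 2 (U × H) →L[ℂ] Tensor (Fin (n k)) (M k)}
    (κ : AUI (WithLp 2 (U × H))) (ιM : ∀ k, AUI (M k))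
    (hG : ∀ k x, G' k x = AUI.tensor (Fin (n k)) (ιM k) (G k (κ x)))
    (Z : Tuple n) (x : WithLp 2 (U × H)) :
    pencil G' Z x = κ (pencil G (conjTuple Z) (κ x)) := by
  refine ext_inner_right ℂ fun y => ?_
  rw [κ.inner_left, inner_pencil_left, ← inner_conj_symm, inner_pencil_left, map_sum]
  refine Finset.sum_congr rfl fun k _ => ?_
  rw [hG, hG, inner_conj_symm, ← AUI.inner_map (AUI.tensor _ (ιM k)) _ (G k (κ y)),
    AUI.tensor_ampl, conjTuple]
  congr 3
  ext i j
  simp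

theorem pencil_real {G : ∀ k, WithLp 2 (U × H) →L[ℂ] Tensor (Fin (n k)) (M k)}
    {κ : AUI (WithLp 2 (U × H))} {ιM : ∀ k, AUI (M k)}
    (hG : ∀ k, IsRealOp κ (AUI.tensor (Fin (n k)) (ιM k)) (G k))
    (Z : Tuple n) (x : WithLp 2 (U × H)) :
    pencil G Z (κ x) = κ (pencil G (conjTuple Z) x) := by
  rw [pencil_conjTuple κ ιM (fun k x => by rw [hG, κ.invol]) Z (κ x), κ.invol]

theorem IsLongResolvent.isRealFun {f : Tuple n → U →L[ℂ] U}
    {G : ∀ k, WithLp 2 (U × H) →L[ℂ] Tensor (Fin (n k)) (M k)} (hf : IsLongResolvent f G)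
    {ι : AUI U} {ιH : AUI H} {ιM : ∀ k, AUI (M k)}
    (hG : ∀ k, IsRealOp (ι.prod ιH) (AUI.tensor (Fin (n k)) (ιM k)) (G k)) :
    IsRealFun ι ι (Omega n) f := by
  rw [isLongResolvent_iff] at hf
  intro Z hZ x
  obtain ⟨h, hh⟩ := (hf _ (conjTuple_mem_Omega hZ)).2 (ι x)
  obtain ⟨h', hh'⟩ := (hf Z hZ).2 x
  have h1 := pencil_real hG Z (WithLp.toLp 2 (ι x, h))
  rw [hh, AUI.prod_toLp, AUI.prod_toLp, ι.invol, ιH.map_zero] at h1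
  -- The conjugated solution at the conjugate tuple and the solution at `Z` share their first
  -- component `x`, so the second row forces them to agree.
  have e1 := eq_neg_inverse_of_snd_eq_zero (hf Z hZ).1 (by rw [h1, WithLp.toLp_snd])
  have e2 := eq_neg_inverse_of_snd_eq_zero (hf Z hZ).1 (by rw [hh', WithLp.toLp_snd])
  rw [e1, ← e2, hh'] at h1
  exact (congrArg WithLp.fst h1).symm

theorem differentiable_pencil (G : ∀ k, WithLp 2 (U × H) →L[ℂ] Tensor (Fin (n k)) (M k)) :
    Differentiable ℂ (pencil G) := by
  let L : Tuple n →ₗ[ℂ] (WithLp 2 (U × H) →L[ℂ] WithLp 2 (U × H)) :=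
    { toFun := pencil G, map_add' := pencil_add G, map_smul' := pencil_smul G }
  exact (LinearMap.toContinuousLinearMap L).differentiable

/-- The solution `x ↦ (x, -d(Z)⁻¹ c(Z) x)` of the equation `A(Z) (x, h) = (f(Z) x, 0)`. -/
def resolventColumn (G : ∀ k, WithLp 2 (U × H) →L[ℂ] Tensor (Fin (n k)) (M k)) (Z : Tuple n) :
    U →L[ℂ] WithLp 2 (U × H) :=
  inlL U H - inrL U H ∘L Ring.inverse (block22 (pencil G Z)) ∘L block21 (pencil G Z)

theorem resolventColumn_apply (G : ∀ k, WithLp 2 (U × H) →L[ℂ] Tensor (Fin (n k)) (M k))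
    (Z : Tuple n) (x : U) :
    resolventColumn G Z x =
      WithLp.toLp 2 (x, -Ring.inverse (block22 (pencil G Z)) (block21 (pencil G Z) x)) := by
  rw [toLp_eq_inlL_add_inrL, map_neg]
  simp [resolventColumn, sub_eq_add_neg]

theorem differentiableOn_resolventColumn
    {G : ∀ k, WithLp 2 (U × H) →L[ℂ] Tensor (Fin (n k)) (M k)} {S : Set (Tuple n)}
    (hS : ∀ Z ∈ S, IsUnit (block22 (pencil G Z))) :
    DifferentiableOn ℂ (resolventColumn G) S := by
  intro Z hZ
  exact (differentiableAt_schurColumn (differentiable_pencil G Z)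
    (hS Z hZ)).differentiableWithinAt

/-- The pencil sends the column at `Z` to `(f(Z)x, 0)`. Pairing with the column at `Y` sees only its
first component `y`, so the result does not depend on `Y`. -/
theorem IsLongResolvent.isDecomposition {f : Tuple n → U →L[ℂ] U}
    {G : ∀ k, WithLp 2 (U × H) →L[ℂ] Tensor (Fin (n k)) (M k)} (hf : IsLongResolvent f G) :
    IsDecomposition f (fun k Z => G k ∘L resolventColumn G Z) := by
  rw [isLongResolvent_iff] at hf
  have hd : ∀ Z ∈ halfplane n, IsUnit (block22 (pencil G Z)) :=
    fun Z hZ => (hf Z (halfplane_subset_Omega hZ)).1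
  refine ⟨fun k => ?_, fun Z hZ Y hY => ?_⟩
  · have := differentiableOn_resolventColumn hd
    fun_prop
  · ext x
    refine ext_inner_right ℂ fun y => ?_
    have h1 : inner ℂ (pencil G Z (resolventColumn G Z x)) (resolventColumn G Y y) =
        inner ℂ (f Z x) y := by
      obtain ⟨h, hh⟩ := (hf Z (halfplane_subset_Omega hZ)).2 x
      rw [resolventColumn_apply, resolventColumn_apply, ← eq_neg_inverse_of_snd_eq_zero (hd Z hZ)
        (y := h) (by rw [hh, WithLp.toLp_snd]), hh]
      simp [WithLp.prod_inner_apply]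
    rw [← h1, inner_pencil_left]
    simp [sum_inner, ContinuousLinearMap.adjoint_inner_left]

theorem IsLongResolvent.isRealFun_decomposition {f : Tuple n → U →L[ℂ] U}
    {G : ∀ k, WithLp 2 (U × H) →L[ℂ] Tensor (Fin (n k)) (M k)} (hf : IsLongResolvent f G)
    {ι : AUI U} {ιH : AUI H} {ιM : ∀ k, AUI (M k)}
    (hG : ∀ k, IsRealOp (ι.prod ιH) (AUI.tensor (Fin (n k)) (ιM k)) (G k)) (k : Fin N) :
    IsRealFun ι (AUI.tensor (Fin (n k)) (ιM k)) (halfplane n)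
      (fun Z => G k ∘L resolventColumn G Z) := by
  intro Z hZ x
  have hd := (hf Z (halfplane_subset_Omega hZ)).1
  have hd' := (hf _ (halfplane_subset_Omega (conjTuple_mem_halfplane hZ))).1
  rw [ContinuousLinearMap.comp_apply, ContinuousLinearMap.comp_apply, hG]
  congr 1
  rw [resolventColumn_apply, resolventColumn_apply, AUI.prod_toLp, ι.invol,
    ← eq_neg_inverse_of_snd_eq_zero hd]
  have h := pencil_real hG Z (WithLp.toLp 2 (ι x,
    -Ring.inverse (block22 (pencil G (conjTuple Z))) (block21 (pencil G (conjTuple Z)) (ι x))))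
  rw [AUI.prod_toLp, ι.invol] at h
  rw [h, AUI.prod_snd, snd_apply_neg_inverse hd', ιH.map_zero]

end Pencil

/-! ### Making a representation real by doubling it. -/

section Doubling

variable {s : Type*} [Fintype s]
  {U : Type*} [NormedAddCommGroup U] [InnerProductSpace ℂ U]
  {H : Type*} [NormedAddCommGroup H] [InnerProductSpace ℂ H]
  {K : Type*} [NormedAddCommGroup K] [InnerProductSpace ℂ K]

/-- The projection `(u, h₁, h₂) ↦ (u, h₁)`. -/
def dropRight (U H : Type*) [NormedAddCommGroup U] [InnerProductSpace ℂ U]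
    [NormedAddCommGroup H] [InnerProductSpace ℂ H] :
    WithLp 2 (U × WithLp 2 (H × H)) →L[ℂ] WithLp 2 (U × H) :=
  inlL U H ∘L WithLp.fstL 2 ℂ U (WithLp 2 (H × H)) +
    inrL U H ∘L WithLp.fstL 2 ℂ H H ∘L WithLp.sndL 2 ℂ U (WithLp 2 (H × H))

/-- The projection `(u, h₁, h₂) ↦ (u, h₂)`. -/
def dropLeft (U H : Type*) [NormedAddCommGroup U] [InnerProductSpace ℂ U]
    [NormedAddCommGroup H] [InnerProductSpace ℂ H] :
    WithLp 2 (U × WithLp 2 (H × H)) →L[ℂ] WithLp 2 (U × H) :=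
  inlL U H ∘L WithLp.fstL 2 ℂ U (WithLp 2 (H × H)) +
    inrL U H ∘L WithLp.sndL 2 ℂ H H ∘L WithLp.sndL 2 ℂ U (WithLp 2 (H × H))

theorem dropRight_apply (x : WithLp 2 (U × WithLp 2 (H × H))) :
    dropRight U H x = WithLp.toLp 2 (x.fst, x.snd.fst) :=
  (toLp_eq_inlL_add_inrL _ _).symm

theorem dropLeft_apply (x : WithLp 2 (U × WithLp 2 (H × H))) :
    dropLeft U H x = WithLp.toLp 2 (x.fst, x.snd.snd) :=
  (toLp_eq_inlL_add_inrL _ _).symm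

/-- The operator `(u, h₁, h₂) ↦ 2^{-1/2} (G (u, h₁), G' (u, h₂))`. -/
def doubleOp (G G' : WithLp 2 (U × H) →L[ℂ] Tensor s K) :
    WithLp 2 (U × WithLp 2 (H × H)) →L[ℂ] Tensor s (WithLp 2 (K × K)) :=
  (PiLp.continuousLinearEquiv 2 ℂ (fun _ : s => WithLp 2 (K × K))).symm.toContinuousLinearMap ∘L
    ContinuousLinearMap.pi fun i => (((√2)⁻¹ : ℝ) : ℂ) •
      (inlL K K ∘L PiLp.proj 2 (𝕜 := ℂ) (fun _ : s => K) i ∘L G ∘L dropRight U H +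
        inrL K K ∘L PiLp.proj 2 (𝕜 := ℂ) (fun _ : s => K) i ∘L G' ∘L dropLeft U H)

theorem doubleOp_apply (G G' : WithLp 2 (U × H) →L[ℂ] Tensor s K)
    (x : WithLp 2 (U × WithLp 2 (H × H))) (i : s) :
    doubleOp G G' x i = (((√2)⁻¹ : ℝ) : ℂ) •
      WithLp.toLp 2 (G (dropRight U H x) i, G' (dropLeft U H x) i) := by
  rw [toLp_eq_inlL_add_inrL]
  rfl

/-- The factor `1/√2` makes the doubled pencil the mean of the two pencils, so that their common
Schur complement is preserved. -/
theorem inner_ampl_doubleOp (G G' : WithLp 2 (U × H) →L[ℂ] Tensor s K) (Z : Matrix s s ℂ)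
    (x y : WithLp 2 (U × WithLp 2 (H × H))) :
    inner ℂ (ampl Z (doubleOp G G' x)) (doubleOp G G' y) =
      (2 : ℂ)⁻¹ * (inner ℂ (ampl Z (G (dropRight U H x))) (G (dropRight U H y)) +
        inner ℂ (ampl Z (G' (dropLeft U H x))) (G' (dropLeft U H y))) := by
  have h2 : ((((√2)⁻¹ : ℝ) : ℂ)) * (((√2)⁻¹ : ℝ) : ℂ) = (2 : ℂ)⁻¹ := by
    rw [← Complex.ofReal_mul, ← mul_inv, Real.mul_self_sqrt (by norm_num)]
    simp
  simp only [PiLp.inner_apply, ampl_apply, doubleOp_apply, sum_inner, inner_smul_left,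
    inner_smul_right, WithLp.prod_inner_apply, Complex.conj_ofReal, ← Finset.sum_add_distrib,
    Finset.mul_sum, ← h2]
  refine Finset.sum_congr rfl fun i _ => Finset.sum_congr rfl fun j _ => ?_
  ring

/-- The swap exchanges `h₁` with `h₂`, while conjugation exchanges `G` with its conjugate. -/
theorem isRealOp_doubleOp (ι : AUI U) (ιH : AUI H) (ιK : AUI K)
    (G : WithLp 2 (U × H) →L[ℂ] Tensor s K) :
    IsRealOp (ι.prod ιH.swap) (AUI.tensor s ιK.swap)
      (doubleOp G ((ι.prod ιH).conjOp (AUI.tensor s ιK) G)) := by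
  intro x
  ext i
  rw [AUI.tensor_apply, doubleOp_apply, doubleOp_apply, AUI.map_smul, Complex.conj_ofReal]
  congr 1
  have h1 : dropRight U H (ι.prod ιH.swap x) = ι.prod ιH (dropLeft U H x) := by
    rw [dropRight_apply, dropLeft_apply]; rfl
  have h2 : dropLeft U H (ι.prod ιH.swap x) = ι.prod ιH (dropRight U H x) := by
    rw [dropRight_apply, dropLeft_apply]; rfl
  rw [h1, h2, AUI.conjOp_apply, AUI.conjOp_apply, AUI.invol, AUI.tensor_apply, AUI.tensor_apply]
  change WithLp.toLp 2 (ιK (ιK _), ιK _) = _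
  rw [ιK.invol, WithLp.toLp_fst]

variable [CompleteSpace U] [CompleteSpace H] {N : ℕ} {n : Fin N → ℕ}
  {M : Fin N → Type*} [∀ k, NormedAddCommGroup (M k)] [∀ k, InnerProductSpace ℂ (M k)]
  [∀ k, CompleteSpace (M k)]

/-- The family of operators `doubleOp (G k) (G' k)`. -/
def doubleFamily (G G' : ∀ k, WithLp 2 (U × H) →L[ℂ] Tensor (Fin (n k)) (M k)) (k : Fin N) :
    WithLp 2 (U × WithLp 2 (H × H)) →L[ℂ] Tensor (Fin (n k)) (WithLp 2 (M k × M k)) :=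
  doubleOp (G k) (G' k)

/-- The pencil of the family `doubleFamily G G'`. -/
def doublePencil (G G' : ∀ k, WithLp 2 (U × H) →L[ℂ] Tensor (Fin (n k)) (M k)) (Z : Tuple n) :
    WithLp 2 (U × WithLp 2 (H × H)) →L[ℂ] WithLp 2 (U × WithLp 2 (H × H)) :=
  pencil (U := U) (H := WithLp 2 (H × H)) (M := fun k => WithLp 2 (M k × M k))
    (doubleFamily G G') Z

theorem inner_doublePencil_left
    (G G' : ∀ k, WithLp 2 (U × H) →L[ℂ] Tensor (Fin (n k)) (M k)) (Z : Tuple n)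
    (x y : WithLp 2 (U × WithLp 2 (H × H))) :
    inner ℂ (doublePencil G G' Z x) y =
      ∑ k, inner ℂ (ampl (Z k) (doubleFamily G G' k x)) (doubleFamily G G' k y) :=
  inner_pencil_left (U := U) (H := WithLp 2 (H × H)) (M := fun k => WithLp 2 (M k × M k))
    (doubleFamily G G') Z x y

theorem doublePencil_apply (G G' : ∀ k, WithLp 2 (U × H) →L[ℂ] Tensor (Fin (n k)) (M k))
    (Z : Tuple n) (x : WithLp 2 (U × WithLp 2 (H × H))) :
    doublePencil G G' Z x = (2 : ℂ)⁻¹ • WithLp.toLp 2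
      ((pencil G Z (dropRight U H x)).fst + (pencil G' Z (dropLeft U H x)).fst,
        WithLp.toLp 2 ((pencil G Z (dropRight U H x)).snd,
          (pencil G' Z (dropLeft U H x)).snd)) := by
  refine ext_inner_right ℂ fun y => ?_
  simp only [inner_doublePencil_left, doubleFamily, inner_ampl_doubleOp]
  rw [← Finset.mul_sum, Finset.sum_add_distrib, ← inner_pencil_left, ← inner_pencil_left,
    inner_smul_left, map_inv₀, map_ofNat]
  simp [dropRight_apply, dropLeft_apply, WithLp.prod_inner_apply, inner_add_left]
  ring

theorem block22_doublePencil_apply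
    (G G' : ∀ k, WithLp 2 (U × H) →L[ℂ] Tensor (Fin (n k)) (M k)) (Z : Tuple n)
    (h : WithLp 2 (H × H)) :
    block22 (E := U) (F := WithLp 2 (H × H)) (doublePencil G G' Z) h =
      (2 : ℂ)⁻¹ •
      WithLp.toLp 2 (block22 (pencil G Z) h.fst, block22 (pencil G' Z) h.snd) := by
  have h1 := snd_apply_toLp (E := U) (F := WithLp 2 (H × H)) (doublePencil G G' Z) 0 h
  rw [map_zero, zero_add, doublePencil_apply, dropRight_apply, dropLeft_apply] at h1
  rw [← h1, WithLp.smul_snd, WithLp.toLp_snd]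
  simp only [WithLp.toLp_fst, WithLp.toLp_snd, snd_apply_toLp, map_zero, zero_add]

theorem isUnit_block22_doublePencil
    {G G' : ∀ k, WithLp 2 (U × H) →L[ℂ] Tensor (Fin (n k)) (M k)} {Z : Tuple n}
    (hd : IsUnit (block22 (pencil G Z))) (hd' : IsUnit (block22 (pencil G' Z))) :
    IsUnit (block22 (E := U) (F := WithLp 2 (H × H)) (doublePencil G G' Z)) := by
  rw [ContinuousLinearMap.isUnit_iff_bijective] at hd hd' ⊢
  have key := block22_doublePencil_apply G G' Z
  generalize block22 (E := U) (F := WithLp 2 (H × H)) (doublePencil G G' Z) = D at key ⊢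
  generalize block22 (pencil G Z) = d at hd key
  generalize block22 (pencil G' Z) = d' at hd' key
  constructor
  · rw [injective_iff_map_eq_zero]
    intro h hh
    rw [key, smul_eq_zero_iff_right (by norm_num)] at hh
    have e1 := congrArg WithLp.fst hh
    have e2 := congrArg WithLp.snd hh
    apply (WithLp.equiv 2 (H × H)).injective
    exact Prod.ext ((injective_iff_map_eq_zero _).1 hd.1 _ e1)
      ((injective_iff_map_eq_zero _).1 hd'.1 _ e2)
  · intro y
    obtain ⟨a, ha⟩ := hd.2 ((2 : ℂ) • y.fst)
    obtain ⟨b, hb⟩ := hd'.2 ((2 : ℂ) • y.snd)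
    refine ⟨WithLp.toLp 2 (a, b), ?_⟩
    rw [key, WithLp.toLp_fst, WithLp.toLp_snd, ha, hb, ← WithLp.toLp_smul, Prod.smul_mk,
      inv_smul_smul₀ two_ne_zero, inv_smul_smul₀ two_ne_zero]
    rfl

/-- The lower right block is half the direct sum of the two old ones. Solutions `a`, `b` for the
same `u` combine into `(a, b)`, with first row `(f(Z)u + f(Z)u)/2`. -/
theorem IsLongResolvent.double {f : Tuple n → U →L[ℂ] U}
    {G G' : ∀ k, WithLp 2 (U × H) →L[ℂ] Tensor (Fin (n k)) (M k)}
    (hG : IsLongResolvent f G) (hG' : IsLongResolvent f G') :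
    IsLongResolvent (H := WithLp 2 (H × H)) (M := fun k => WithLp 2 (M k × M k)) f
      (doubleFamily G G') := by
  rw [isLongResolvent_iff] at hG hG'
  refine (isLongResolvent_iff (U := U) (H := WithLp 2 (H × H))
    (M := fun k => WithLp 2 (M k × M k))).2 fun Z hZ => ?_
  obtain ⟨hd, hf⟩ := hG Z hZ
  obtain ⟨hd', hf'⟩ := hG' Z hZ
  refine ⟨isUnit_block22_doublePencil hd hd', fun u => ?_⟩
  obtain ⟨a, ha⟩ := hf u
  obtain ⟨b, hb⟩ := hf' u
  refine ⟨WithLp.toLp 2 (a, b), (doublePencil_apply G G' Z _).trans ?_⟩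
  rw [dropRight_apply, dropLeft_apply]
  simp only [WithLp.toLp_fst, WithLp.toLp_snd, ha, hb]
  rw [← WithLp.toLp_smul, Prod.smul_mk, ← two_smul ℂ (f Z u), inv_smul_smul₀ two_ne_zero]
  congr 2
  exact smul_zero _

theorem IsLongResolvent.conjOp {f : Tuple n → U →L[ℂ] U}
    {G : ∀ k, WithLp 2 (U × H) →L[ℂ] Tensor (Fin (n k)) (M k)} (hG : IsLongResolvent f G)
    {ι : AUI U} (hf : IsRealFun ι ι (Omega n) f) (ιH : AUI H) (ιM : ∀ k, AUI (M k)) :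
    IsLongResolvent f
      (fun k => (ι.prod ιH).conjOp (AUI.tensor (Fin (n k)) (ιM k)) (G k)) := by
  rw [isLongResolvent_iff] at hG ⊢
  intro Z hZ
  obtain ⟨hd, h⟩ := hG _ (conjTuple_mem_Omega hZ)
  have key := pencil_conjTuple (G := G) (ι.prod ιH) ιM
    (fun k x => AUI.conjOp_apply (ι.prod ιH) (AUI.tensor (Fin (n k)) (ιM k)) (G k) x) Z
  constructor
  · rw [ContinuousLinearMap.isUnit_iff_bijective] at hd ⊢
    have e : (block22 (pencil (fun k =>
        (ι.prod ιH).conjOp (AUI.tensor (Fin (n k)) (ιM k)) (G k)) Z) : H → H) =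
        ιH ∘ block22 (pencil G (conjTuple Z)) ∘ ιH := by
      funext x
      have h1 := congrArg WithLp.snd (key (WithLp.toLp 2 (0, x)))
      rw [snd_apply_toLp, AUI.prod_snd, AUI.prod_toLp, snd_apply_toLp, ι.map_zero, map_zero,
        map_zero, zero_add, zero_add] at h1
      exact h1
    rw [e]
    exact ιH.bijective.comp (hd.comp ιH.bijective)
  · intro u
    obtain ⟨x, hx⟩ := h (ι u)
    refine ⟨ιH x, ?_⟩
    rw [key, AUI.prod_toLp ι ιH u, ιH.invol, hx, AUI.prod_toLp, ιH.map_zero, hf Z hZ]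

end Doubling

/-! ### Gathering the `N` components into one space. -/

section TotalTensor

variable {N : ℕ} {n : Fin N → ℕ}
  {U : Type*} [NormedAddCommGroup U] [InnerProductSpace ℂ U]
  {X : Type*} [NormedAddCommGroup X] [InnerProductSpace ℂ X]
  {M : Fin N → Type*} [∀ k, NormedAddCommGroup (M k)] [∀ k, InnerProductSpace ℂ (M k)]

theorem ampl_blockDiagonal'_apply (Z : Tuple n) (x : Tensor (TotalIndex n) X) (k : Fin N)
    (i : Fin (n k)) :
    ampl (Matrix.blockDiagonal' Z) x ⟨k, i⟩ = ∑ j, Z k i j • x ⟨k, j⟩ := by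
  rw [ampl_apply, Fintype.sum_sigma, Finset.sum_eq_single k]
  · simp [Matrix.blockDiagonal'_apply_eq]
  · intro l _ hl
    exact Finset.sum_eq_zero fun j _ => by
      rw [Matrix.blockDiagonal'_apply_ne _ _ _ hl.symm, zero_smul]
  · simp

/-- The projection of `ℂ^{n_1 + ⋯ + n_N} ⊗ X` onto its `k`-th summand `ℂ^{n_k} ⊗ X`. -/
def tensorProj (X : Type*) [NormedAddCommGroup X] [InnerProductSpace ℂ X] (k : Fin N) :
    Tensor (TotalIndex n) X →L[ℂ] Tensor (Fin (n k)) X :=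
  (PiLp.continuousLinearEquiv 2 ℂ (fun _ : Fin (n k) => X)).symm.toContinuousLinearMap ∘L
    ContinuousLinearMap.pi fun i =>
      PiLp.proj 2 (𝕜 := ℂ) (fun _ : TotalIndex n => X) ⟨k, i⟩

theorem inner_ampl_blockDiagonal' (Z : Tuple n) (x y : Tensor (TotalIndex n) X) :
    inner ℂ (ampl (Matrix.blockDiagonal' Z) x) y =
      ∑ k, inner ℂ (ampl (Z k) (tensorProj X k x)) (tensorProj X k y) := by
  rw [PiLp.inner_apply, Fintype.sum_sigma]
  refine Finset.sum_congr rfl fun k _ => ?_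
  rw [PiLp.inner_apply]
  refine Finset.sum_congr rfl fun i _ => ?_
  rw [ampl_blockDiagonal'_apply, ampl_apply]
  rfl

/-- The operator with components `g k`, where `M k` is identified with a summand of `⊕ M k`. -/
def tensorColumn (g : ∀ k, U →L[ℂ] Tensor (Fin (n k)) (M k)) :
    U →L[ℂ] Tensor (TotalIndex n) (PiLp 2 M) :=
  (PiLp.continuousLinearEquiv 2 ℂ (fun _ : TotalIndex n => PiLp 2 M)).symm.toContinuousLinearMap ∘L
    ContinuousLinearMap.pi fun p =>
      (PiLp.continuousLinearEquiv 2 ℂ M).symm.toContinuousLinearMap ∘L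
        ContinuousLinearMap.single ℂ M p.1 ∘L
          PiLp.proj 2 (𝕜 := ℂ) (fun _ : Fin (n p.1) => M p.1) p.2 ∘L g p.1

theorem tensorColumn_apply (g : ∀ k, U →L[ℂ] Tensor (Fin (n k)) (M k)) (x : U) (k : Fin N)
    (i : Fin (n k)) : tensorColumn g x ⟨k, i⟩ = PiLp.single 2 k (g k x i) := rfl

theorem inner_piLp_single (k : Fin N) (a b : M k) :
    inner ℂ (PiLp.single 2 k a) (PiLp.single 2 k b) = inner ℂ a b := by
  rw [PiLp.inner_apply, Finset.sum_eq_single k]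
  · simp
  · intro l _ hl
    simp [hl]
  · simp

/-- Block-diagonality prevents cross terms; embedding each `M k` in the direct sum only provides a
common coefficient space. -/
theorem inner_ampl_tensorColumn (g g' : ∀ k, U →L[ℂ] Tensor (Fin (n k)) (M k)) (Z : Tuple n)
    (x y : U) :
    inner ℂ (ampl (Matrix.blockDiagonal' Z) (tensorColumn g x)) (tensorColumn g' y) =
      ∑ k, inner ℂ (ampl (Z k) (g k x)) (g' k y) := by
  rw [PiLp.inner_apply, Fintype.sum_sigma]
  refine Finset.sum_congr rfl fun k _ => ?_
  rw [PiLp.inner_apply]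
  refine Finset.sum_congr rfl fun i _ => ?_
  rw [ampl_blockDiagonal'_apply, ampl_apply, sum_inner, sum_inner]
  refine Finset.sum_congr rfl fun j _ => ?_
  rw [inner_smul_left, inner_smul_left, tensorColumn_apply, tensorColumn_apply, inner_piLp_single]

/-- The direct sum of anti-unitary involutions. -/
def AUI.pi (ιM : ∀ k, AUI (M k)) : AUI (PiLp 2 M) where
  toFun x := WithLp.toLp 2 fun k => ιM k (x k)
  invol x := by
    ext k
    simp [(ιM k).invol]
  inner_map x y := by
    simp [PiLp.inner_apply, (ιM _).inner_map]

theorem AUI.pi_single (ιM : ∀ k, AUI (M k)) (k : Fin N) (a : M k) :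
    AUI.pi ιM (PiLp.single 2 k a) = PiLp.single 2 k (ιM k a) := by
  ext l
  change ιM l (PiLp.single 2 k a l) = _
  rcases eq_or_ne l k with rfl | hl
  · simp
  · simp [hl, (ιM l).map_zero]

theorem AUI.tensor_tensorColumn (ιM : ∀ k, AUI (M k))
    {g g' : ∀ k, U →L[ℂ] Tensor (Fin (n k)) (M k)} {x y : U}
    (h : ∀ k, AUI.tensor (Fin (n k)) (ιM k) (g k x) = g' k y) :
    AUI.tensor (TotalIndex n) (AUI.pi ιM) (tensorColumn g x) = tensorColumn g' y := by
  ext p : 1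
  obtain ⟨k, i⟩ := p
  rw [AUI.tensor_apply, tensorColumn_apply, tensorColumn_apply, AUI.pi_single, ← h]
  rfl

end TotalTensor

/-! ### From a decomposition to a pencil on the halfplanes. -/

section DiagDecomposition

variable {N : ℕ} {n : Fin N → ℕ}
  {U : Type*} [NormedAddCommGroup U] [InnerProductSpace ℂ U]
  {X : Type*} [NormedAddCommGroup X] [InnerProductSpace ℂ X]

/-- The identity `f(Z) = φ(Y)^* (diag(Z_1, …, Z_N) ⊗ I_X) φ(Z)` on the product of halfplanes,
without any regularity of `φ`. -/
def IsDiagDecomposition (f : Tuple n → U →L[ℂ] U)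
    (φ : Tuple n → U →L[ℂ] Tensor (TotalIndex n) X) : Prop :=
  ∀ Z ∈ halfplane n, ∀ Y ∈ halfplane n, ∀ x y,
    inner ℂ (f Z x) y = inner ℂ (ampl (Matrix.blockDiagonal' Z) (φ Z x)) (φ Y y)

theorem IsDecomposition.isDiagDecomposition [CompleteSpace U] {M : Fin N → Type*}
    [∀ k, NormedAddCommGroup (M k)] [∀ k, InnerProductSpace ℂ (M k)] [∀ k, CompleteSpace (M k)]
    {f : Tuple n → U →L[ℂ] U} {φ : ∀ k, Tuple n → U →L[ℂ] Tensor (Fin (n k)) (M k)}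
    (h : IsDecomposition f φ) :
    IsDiagDecomposition f (fun Z => tensorColumn fun k => φ k Z) := by
  intro Z hZ Y hY x y
  rw [inner_ampl_tensorColumn, h.2 Z hZ Y hY]
  simp [ContinuousLinearMap.adjoint_inner_left]

theorem IsDiagDecomposition.isRealFun {f : Tuple n → U →L[ℂ] U}
    {φ : Tuple n → U →L[ℂ] Tensor (TotalIndex n) X} (h : IsDiagDecomposition f φ)
    {ι : AUI U} {ιX : AUI X}
    (hφ : IsRealFun ι (AUI.tensor (TotalIndex n) ιX) (halfplane n) φ) :
    IsRealFun ι ι (halfplane n) f := by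
  intro Z hZ x
  refine ext_inner_right ℂ fun y => ?_
  rw [ι.inner_left, ← inner_conj_symm, h _ (conjTuple_mem_halfplane hZ) _
    (conjTuple_mem_halfplane hZ), inner_conj_symm, h Z hZ Z hZ, ← hφ Z hZ, ← hφ Z hZ,
    ← AUI.inner_map (AUI.tensor (TotalIndex n) ιX) _ (φ (conjTuple Z) (ι y)), AUI.tensor_ampl,
    ← blockDiagonal'_conjTuple, conjTuple_conjTuple]

/-- The closed span of the differences `φ(Z) x - φ(I) x`. -/
def stateSpace (φ : Tuple n → U →L[ℂ] Tensor (TotalIndex n) X) :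
    Submodule ℂ (Tensor (TotalIndex n) X) :=
  (Submodule.span ℂ {t | ∃ Z ∈ halfplane n, ∃ x, t = φ Z x - φ 1 x}).topologicalClosure

theorem sub_mem_stateSpace (φ : Tuple n → U →L[ℂ] Tensor (TotalIndex n) X) {Z : Tuple n}
    (hZ : Z ∈ halfplane n) (x : U) : φ Z x - φ 1 x ∈ stateSpace φ :=
  Submodule.le_topologicalClosure _ (Submodule.subset_span ⟨Z, hZ, x, rfl⟩)

instance [CompleteSpace X] (φ : Tuple n → U →L[ℂ] Tensor (TotalIndex n) X) :
    CompleteSpace (stateSpace φ) :=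
  inferInstanceAs (CompleteSpace (Submodule.topologicalClosure _))

theorem map_mem_stateSpace {φ : Tuple n → U →L[ℂ] Tensor (TotalIndex n) X} {ι : AUI U}
    {ιX : AUI X} (hφ : IsRealFun ι (AUI.tensor (TotalIndex n) ιX) (halfplane n) φ) :
    ∀ t ∈ stateSpace φ, AUI.tensor (TotalIndex n) ιX t ∈ stateSpace φ := by
  intro t ht
  refine AUI.mem_closure_span _ ?_ ht
  rintro _ ⟨Z, hZ, x, rfl⟩
  refine ⟨conjTuple Z, conjTuple_mem_halfplane hZ, ι x, ?_⟩
  have h1 := hφ _ (conjTuple_mem_halfplane hZ) (ι x)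
  have h2 := hφ _ one_mem_halfplane (ι x)
  rw [ι.invol] at h1 h2
  rw [conjTuple_conjTuple] at h1
  rw [conjTuple_one] at h2
  rw [AUI.map_sub, h1, h2]

/-- The pairing with `φ(Y)y` equals `⟨f(Z)x, y⟩` for every `Y`, so it vanishes on differences in
`Y`. -/
theorem IsDiagDecomposition.inner_eq_zero {f : Tuple n → U →L[ℂ] U}
    {φ : Tuple n → U →L[ℂ] Tensor (TotalIndex n) X} (h : IsDiagDecomposition f φ)
    {Z : Tuple n} (hZ : Z ∈ halfplane n) (x : U) {t : Tensor (TotalIndex n) X}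
    (ht : t ∈ stateSpace φ) :
    inner ℂ (ampl (Matrix.blockDiagonal' Z) (φ Z x)) t = 0 := by
  have hle : stateSpace φ ≤ (ℂ ∙ ampl (Matrix.blockDiagonal' Z) (φ Z x))ᗮ := by
    refine Submodule.topologicalClosure_minimal _ (Submodule.span_le.2 ?_)
      (Submodule.isClosed_orthogonal _)
    rintro _ ⟨Y, hY, y, rfl⟩
    rw [SetLike.mem_coe, Submodule.mem_orthogonal_singleton_iff_inner_right, inner_sub_right,
      ← h Z hZ Y hY, ← h Z hZ 1 one_mem_halfplane, sub_self]
  exact Submodule.mem_orthogonal_singleton_iff_inner_right.1 (hle ht)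

/-- The operator `(x, t) ↦ φ(I) x + t` on `U ⊕ stateSpace φ`. -/
def colligation (φ : Tuple n → U →L[ℂ] Tensor (TotalIndex n) X) :
    WithLp 2 (U × stateSpace φ) →L[ℂ] Tensor (TotalIndex n) X :=
  φ 1 ∘L WithLp.fstL 2 ℂ U (stateSpace φ) +
    (stateSpace φ).subtypeL ∘L WithLp.sndL 2 ℂ U (stateSpace φ)

theorem colligation_apply (φ : Tuple n → U →L[ℂ] Tensor (TotalIndex n) X)
    (x : WithLp 2 (U × stateSpace φ)) :
    colligation φ x = φ 1 x.fst + (x.snd : Tensor (TotalIndex n) X) := rfl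

/-- The components of `colligation φ`. -/
def colligationComponent (φ : Tuple n → U →L[ℂ] Tensor (TotalIndex n) X) (k : Fin N) :
    WithLp 2 (U × stateSpace φ) →L[ℂ] Tensor (Fin (n k)) X :=
  tensorProj X k ∘L colligation φ

theorem isRealOp_colligationComponent {φ : Tuple n → U →L[ℂ] Tensor (TotalIndex n) X}
    {ι : AUI U} {ιX : AUI X}
    (hφ : IsRealFun ι (AUI.tensor (TotalIndex n) ιX) (halfplane n) φ) (k : Fin N) :
    IsRealOp (ι.prod ((AUI.tensor (TotalIndex n) ιX).restrict _ (map_mem_stateSpace hφ)))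
      (AUI.tensor (Fin (n k)) ιX) (colligationComponent φ k) := by
  intro x
  have h2 := hφ _ one_mem_halfplane (ι x.fst)
  rw [conjTuple_one, ι.invol] at h2
  ext i
  rw [AUI.tensor_apply]
  change ιX (colligation φ x ⟨k, i⟩) = colligation φ _ ⟨k, i⟩
  rw [colligation_apply, colligation_apply, AUI.prod_fst, ← h2, AUI.prod_snd, PiLp.add_apply,
    ιX.map_add]
  rfl

variable [CompleteSpace U] [CompleteSpace X]

/-- The pencil of the family `colligationComponent φ`. -/
def statePencil (φ : Tuple n → U →L[ℂ] Tensor (TotalIndex n) X) (Z : Tuple n) :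
    WithLp 2 (U × stateSpace φ) →L[ℂ] WithLp 2 (U × stateSpace φ) :=
  pencil (U := U) (H := stateSpace φ) (M := fun _ => X) (colligationComponent φ) Z

theorem inner_statePencil_left (φ : Tuple n → U →L[ℂ] Tensor (TotalIndex n) X) (Z : Tuple n)
    (x y : WithLp 2 (U × stateSpace φ)) :
    inner ℂ (statePencil φ Z x) y =
      inner ℂ (ampl (Matrix.blockDiagonal' Z) (colligation φ x)) (colligation φ y) := by
  rw [inner_ampl_blockDiagonal']
  exact inner_pencil_left (U := U) (H := stateSpace φ) (M := fun _ => X) _ _ _ _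

theorem statePencil_smul (φ : Tuple n → U →L[ℂ] Tensor (TotalIndex n) X) (c : ℂ) (Z : Tuple n) :
    statePencil φ (c • Z) = c • statePencil φ Z :=
  pencil_smul (U := U) (H := stateSpace φ) (M := fun _ => X) _ _ _

/-- This block is the compression of `Z ⊗ I` to the state space, hence inherits its coercivity. -/
theorem isUnit_block22_statePencil (φ : Tuple n → U →L[ℂ] Tensor (TotalIndex n) X)
    {Z : Tuple n} (hZ : Z ∈ halfplane n) : IsUnit (block22 (statePencil φ Z)) := by
  obtain ⟨ε, hε, h⟩ :=
    exists_le_re_inner_ampl_of_add_conjTranspose (E := X) (posDef_blockDiagonal'_add hZ)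
  refine ContinuousLinearMap.isUnit_of_forall_le_norm_inner_map _ (c := ⟨ε, hε.le⟩) hε fun t => ?_
  have h1 : inner ℂ (block22 (statePencil φ Z) t) t =
      inner ℂ (ampl (Matrix.blockDiagonal' Z) (t : Tensor (TotalIndex n) X))
        (t : Tensor (TotalIndex n) X) := by
    have h2 := inner_statePencil_left φ Z (WithLp.toLp 2 (0, t)) (WithLp.toLp 2 (0, t))
    rw [WithLp.prod_inner_apply, colligation_apply] at h2
    simpa [snd_apply_toLp] using h2
  rw [h1]
  refine le_trans ?_ ((h t).trans ((Complex.re_le_norm _)))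
  rw [mul_comm]
  exact le_rfl

/-- The colligation sends this vector to `φ(Z)x`; in the pairing with `(y, t)` the `t` part drops
out by `inner_eq_zero`. -/
theorem IsDiagDecomposition.statePencil_apply {f : Tuple n → U →L[ℂ] U}
    {φ : Tuple n → U →L[ℂ] Tensor (TotalIndex n) X} (h : IsDiagDecomposition f φ)
    {Z : Tuple n} (hZ : Z ∈ halfplane n) (x : U) :
    statePencil φ Z (WithLp.toLp 2 (x, ⟨φ Z x - φ 1 x, sub_mem_stateSpace φ hZ x⟩)) =
      WithLp.toLp 2 (f Z x, 0) := by
  refine ext_inner_right ℂ fun y => ?_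
  rw [inner_statePencil_left, colligation_apply, colligation_apply, WithLp.toLp_fst,
    WithLp.toLp_snd, add_sub_cancel, inner_add_right, h.inner_eq_zero hZ x y.snd.2, add_zero,
    ← h Z hZ 1 one_mem_halfplane, WithLp.prod_inner_apply]
  simp

/-- The second-row equation is unaffected by scaling `Z`, so its unique solution, hence `φ(Z)x`
itself, is the same at `rZ` and `Z`. -/
theorem IsDiagDecomposition.map_smul_of_pos {f : Tuple n → U →L[ℂ] U}
    {φ : Tuple n → U →L[ℂ] Tensor (TotalIndex n) X} (h : IsDiagDecomposition f φ)
    {r : ℝ} (hr : 0 < r) {Z : Tuple n} (hZ : Z ∈ halfplane n) :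
    f ((r : ℂ) • Z) = (r : ℂ) • f Z := by
  ext x
  have hr' : (r : ℂ) ≠ 0 := by exact_mod_cast hr.ne'
  have h1 := h.statePencil_apply (smul_mem_halfplane hr hZ) x
  have h2 := h.statePencil_apply hZ x
  set t1 : stateSpace φ := ⟨φ ((r : ℂ) • Z) x - φ 1 x, _⟩
  set t2 : stateSpace φ := ⟨φ Z x - φ 1 x, _⟩
  rw [statePencil_smul] at h1
  have hd := isUnit_block22_statePencil φ hZ
  have e1 : (statePencil φ Z (WithLp.toLp 2 (x, t1))).snd = 0 := by
    have := congrArg WithLp.snd h1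
    rw [smul_apply, WithLp.smul_snd] at this
    exact (smul_eq_zero.1 this).resolve_left hr'
  have e2 : (statePencil φ Z (WithLp.toLp 2 (x, t2))).snd = 0 := by rw [h2, WithLp.toLp_snd]
  have e : t1 = t2 :=
    (eq_neg_inverse_of_snd_eq_zero hd e1).trans (eq_neg_inverse_of_snd_eq_zero hd e2).symm
  rw [e, smul_apply, h2] at h1
  exact (congrArg WithLp.fst h1).symm


end DiagDecomposition

/-! ### Complex homogeneity by analytic continuation. -/

section Homogeneity

variable {N : ℕ} {n : Fin N → ℕ}
  {U : Type*} [NormedAddCommGroup U] [InnerProductSpace ℂ U] [CompleteSpace U]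

/-- A holomorphic function on `Ω` that is positively homogeneous on the product of halfplanes is
homogeneous under complex rotations. -/
theorem map_smul_of_pos_homogeneous {f : Tuple n → U →L[ℂ] U}
    (hf : DifferentiableOn ℂ f (Omega n))
    (hom : ∀ r : ℝ, 0 < r → ∀ Z ∈ halfplane n, f ((r : ℂ) • Z) = (r : ℂ) • f Z)
    {c : ℂ} (hc : c ≠ 0) {Z : Tuple n} (hZ : Z ∈ halfplane n) : f (c • Z) = c • f Z := by
  have h1 : Differentiable ℂ fun w : ℂ => f (Complex.exp w • Z) := by
    rw [← differentiableOn_univ]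
    refine DifferentiableOn.comp (g := f) (t := Omega n) hf ?_
      fun w _ => exp_smul_mem_Omega hZ w
    exact (Complex.differentiable_exp.smul_const Z).differentiableOn
  have h2 : Differentiable ℂ fun w : ℂ => Complex.exp w • f Z :=
    Complex.differentiable_exp.smul_const (f Z)
  -- Real `w` accumulate at `0`, and there positive homogeneity gives equality.
  have hfreq : ∃ᶠ w in nhdsWithin (0 : ℂ) {0}ᶜ,
      f (Complex.exp w • Z) = Complex.exp w • f Z := by
    have ht : Filter.Tendsto (fun r : ℝ => (r : ℂ)) (nhdsWithin 0 {0}ᶜ) (nhdsWithin 0 {0}ᶜ) := by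
      refine tendsto_nhdsWithin_iff.2 ⟨?_, ?_⟩
      · exact (Complex.continuous_ofReal.tendsto' 0 0 rfl).mono_left nhdsWithin_le_nhds
      · filter_upwards [self_mem_nhdsWithin] with r hr
        simpa using hr
    refine ht.frequently (Filter.Frequently.of_forall fun r => ?_)
    rw [← Complex.ofReal_exp]
    exact hom _ (Real.exp_pos r) Z hZ
  have h := AnalyticOnNhd.eq_of_frequently_eq (fun w _ => h1.analyticAt w)
    (fun w _ => h2.analyticAt w) hfreq
  have := congrFun h (Complex.log c)
  simpa [Complex.exp_log hc] using this

end Homogeneity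

/-! ### Long resolvents on all of `Omega`. -/

section LongResolvent

variable {N : ℕ} {n : Fin N → ℕ}
  {U : Type*} [NormedAddCommGroup U] [InnerProductSpace ℂ U] [CompleteSpace U]
  {X : Type*} [NormedAddCommGroup X] [InnerProductSpace ℂ X] [CompleteSpace X]

/-- Both the pencil and `f` are homogeneous, so the system solved at `Y` in the halfplanes is solved
at `c • Y` by the same vector. -/
theorem IsDiagDecomposition.isLongResolvent {f : Tuple n → U →L[ℂ] U}
    (hf : DifferentiableOn ℂ f (Omega n))
    {φ : Tuple n → U →L[ℂ] Tensor (TotalIndex n) X} (h : IsDiagDecomposition f φ) :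
    IsLongResolvent (H := stateSpace φ) (M := fun _ => X) f (colligationComponent φ) := by
  refine (isLongResolvent_iff (U := U) (H := stateSpace φ) (M := fun _ => X)).2 fun Z hZ => ?_
  obtain ⟨c, hc, Y, hY, rfl⟩ := hZ
  have hc0 : c ≠ 0 := by
    rintro rfl
    simp at hc
  change IsUnit (block22 (statePencil φ (c • Y))) ∧ ∀ u, ∃ t,
    statePencil φ (c • Y) (WithLp.toLp 2 (u, t)) = WithLp.toLp 2 (f (c • Y) u, 0)
  rw [statePencil_smul, map_smul_of_pos_homogeneous hf (fun r hr Z hZ => h.map_smul_of_pos hr hZ)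
    hc0 hY]
  constructor
  · have e : block22 (c • statePencil φ Y) = Units.mk0 c hc0 • block22 (statePencil φ Y) := by
      ext t
      rfl
    rw [e]
    exact (isUnit_block22_statePencil φ hY).smul _
  · intro u
    refine ⟨_, (congrArg (c • ·) (h.statePencil_apply hY u)).trans ?_⟩
    rw [← WithLp.toLp_smul, Prod.smul_mk, smul_zero]
    rfl

end LongResolvent

/-! ### Transfer functions of self-adjoint unitary operators. -/

section Transfer

variable {E F : Type*} [NormedAddCommGroup E] [InnerProductSpace ℂ E]
  [NormedAddCommGroup F] [InnerProductSpace ℂ F]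

/-- The first row reads `(1 - A W) t = B x`; eliminating `t` from the second gives the transfer
function. -/
theorem eq_inverse_of_apply_eq {T : WithLp 2 (E × F) →L[ℂ] WithLp 2 (E × F)} {W : E →L[ℂ] E}
    (hu : IsUnit (1 - block11 T ∘L W)) {t : E} {x y : F}
    (h : T (WithLp.toLp 2 (W t, x)) = WithLp.toLp 2 (t, y)) :
    y = (block22 T + block21 T ∘L W ∘L Ring.inverse (1 - block11 T ∘L W) ∘L block12 T) x := by
  have h1 := fst_apply_toLp T (W t) x
  have h2 := snd_apply_toLp T (W t) x
  rw [h, WithLp.toLp_fst] at h1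
  rw [h, WithLp.toLp_snd] at h2
  have h3 : (1 - block11 T ∘L W) t = block12 T x := by
    change t - block11 T (W t) = _
    rw [sub_eq_iff_eq_add, add_comm]
    exact h1
  have h4 : Ring.inverse (1 - block11 T ∘L W) (block12 T x) = t := by
    rw [← h3, inverse_apply_apply hu]
  refine h2.trans ?_
  change _ = block22 T x + block21 T (W (Ring.inverse (1 - block11 T ∘L W) (block12 T x)))
  rw [h4, add_comm]

theorem apply_inverse_eq {T : WithLp 2 (E × F) →L[ℂ] WithLp 2 (E × F)} {W : E →L[ℂ] E}
    (hu : IsUnit (1 - block11 T ∘L W)) (x : F) :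
    T (WithLp.toLp 2 (W (Ring.inverse (1 - block11 T ∘L W) (block12 T x)), x)) =
      WithLp.toLp 2 (Ring.inverse (1 - block11 T ∘L W) (block12 T x),
        (block22 T + block21 T ∘L W ∘L Ring.inverse (1 - block11 T ∘L W) ∘L block12 T) x) := by
  apply (WithLp.equiv 2 (E × F)).injective
  refine Prod.ext ((fst_apply_toLp _ _ _).trans ?_)
    ((snd_apply_toLp _ _ _).trans (add_comm _ _))
  have h := apply_inverse_apply hu (block12 T x)
  set t := Ring.inverse (1 - block11 T ∘L W) (block12 T x)
  rw [← h]
  change block11 T (W t) + (t - block11 T (W t)) = t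
  rw [add_sub_cancel]

variable [CompleteSpace E]

theorem norm_apply_of_adjoint_eq_self {T : E →L[ℂ] E} (hT : ContinuousLinearMap.adjoint T = T)
    (hTT : T * T = 1) (x : E) : ‖T x‖ = ‖x‖ := by
  have h1 : T (T x) = x := congrArg (fun S : E →L[ℂ] E => S x) hTT
  rw [norm_eq_sqrt_re_inner (𝕜 := ℂ), norm_eq_sqrt_re_inner (𝕜 := ℂ),
    ← ContinuousLinearMap.adjoint_inner_left, hT, h1]

theorem inner_eq_zero_of_apply_eq {T : E →L[ℂ] E} (hT : ContinuousLinearMap.adjoint T = T)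
    {p q : E} (hp : T p = p) (hq : T q = -q) : inner ℂ p q = 0 := by
  have h : inner ℂ p q = -inner ℂ p q := by
    calc inner ℂ p q = inner ℂ (T p) q := by rw [hp]
      _ = inner ℂ p (T q) := by rw [← ContinuousLinearMap.adjoint_inner_right, hT]
      _ = -inner ℂ p q := by rw [hq, inner_neg_right]
  exact self_eq_neg.1 h

/-- `T` is isometric, so its corner is a contraction and the Neumann series converges. -/
theorem isUnit_one_sub_block11 [CompleteSpace F] {T : WithLp 2 (E × F) →L[ℂ] WithLp 2 (E × F)}
    (hT : ContinuousLinearMap.adjoint T = T) (hTT : T * T = 1) {W : E →L[ℂ] E} (hW : ‖W‖ < 1) :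
    IsUnit (1 - block11 T ∘L W) := by
  refine isUnit_one_sub_of_norm_lt_one (lt_of_le_of_lt ?_ hW)
  refine ContinuousLinearMap.opNorm_le_bound _ (norm_nonneg _) fun x => ?_
  refine le_trans ?_ (W.le_opNorm x)
  have h1 := fst_apply_toLp T (W x) 0
  rw [map_zero, add_zero] at h1
  rw [ContinuousLinearMap.comp_apply, ← h1]
  refine (WithLp.norm_fst_le _ _).trans ?_
  rw [norm_apply_of_adjoint_eq_self hT hTT]
  exact (WithLp.norm_toLp_fst 2 E F (W x)).le

end Transfer

/-! ### Reflections in closed subspaces. -/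

section Reflection

variable {E : Type*} [NormedAddCommGroup E] [InnerProductSpace ℂ E]

/-- The reflection in a closed subspace as a bounded operator. -/
def reflectionL (S : Submodule ℂ E) [S.HasOrthogonalProjection] : E →L[ℂ] E :=
  S.reflection.toContinuousLinearEquiv.toContinuousLinearMap

theorem reflectionL_apply (S : Submodule ℂ E) [S.HasOrthogonalProjection] (x : E) :
    reflectionL S x = S.reflection x := rfl

theorem reflectionL_mul_self (S : Submodule ℂ E) [S.HasOrthogonalProjection] :
    reflectionL S * reflectionL S = 1 := by
  ext x
  exact S.reflection_reflection x

theorem reflectionL_add {S : Submodule ℂ E} [S.HasOrthogonalProjection] {p q : E} (hp : p ∈ S)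
    (hq : q ∈ Sᗮ) : reflectionL S (p + q) = p - q := by
  rw [map_add, reflectionL_apply, reflectionL_apply, S.reflection_mem_subspace_eq_self hp,
    S.reflection_mem_subspace_orthogonalComplement_eq_neg hq, sub_eq_add_neg]

theorem adjoint_reflectionL [CompleteSpace E] (S : Submodule ℂ E) [S.HasOrthogonalProjection] :
    ContinuousLinearMap.adjoint (reflectionL S) = reflectionL S := by
  symm
  rw [ContinuousLinearMap.eq_adjoint_iff]
  intro x y
  rw [reflectionL_apply, reflectionL_apply, ← S.reflection.inner_map_map x,
    S.reflection_reflection]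

theorem isRealOp_reflectionL (ι : AUI E) {S : Submodule ℂ E} [S.HasOrthogonalProjection]
    (hS : ∀ x ∈ S, ι x ∈ S) : IsRealOp ι ι (reflectionL S) := by
  intro x
  obtain ⟨p, hp, q, hq, rfl⟩ := S.exists_add_mem_mem_orthogonal x
  -- Invariance passes to the orthogonal complement, so `ι` respects the splitting that defines the
  -- reflection.
  have hq' : ι q ∈ Sᗮ := by
    intro y hy
    have := hq _ (hS y hy)
    rwa [ι.inner_left, ← inner_conj_symm, map_eq_zero] at this
  rw [reflectionL_add hp hq, ι.map_add, reflectionL_add (hS p hp) hq', ι.map_sub]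

end Reflection

/-! ### Between decompositions and realizations. -/

section Realization

variable {N : ℕ} {n : Fin N → ℕ}
  {U : Type*} [NormedAddCommGroup U] [InnerProductSpace ℂ U]
  {X : Type*} [NormedAddCommGroup X] [InnerProductSpace ℂ X]

/-- The closed span of the vectors `(Z φ(Z) x, f(Z) x)`. -/
def graphSpace (f : Tuple n → U →L[ℂ] U) (φ : Tuple n → U →L[ℂ] Tensor (TotalIndex n) X) :
    Submodule ℂ (WithLp 2 (Tensor (TotalIndex n) X × U)) :=
  (Submodule.span ℂ {p | ∃ Z ∈ halfplane n, ∃ x,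
    p = WithLp.toLp 2 (ampl (Matrix.blockDiagonal' Z) (φ Z x), f Z x)}).topologicalClosure

instance [CompleteSpace U] [CompleteSpace X] (f : Tuple n → U →L[ℂ] U)
    (φ : Tuple n → U →L[ℂ] Tensor (TotalIndex n) X) : CompleteSpace (graphSpace f φ) :=
  inferInstanceAs (CompleteSpace (Submodule.topologicalClosure _))

theorem mem_graphSpace (f : Tuple n → U →L[ℂ] U) (φ : Tuple n → U →L[ℂ] Tensor (TotalIndex n) X)
    {Z : Tuple n} (hZ : Z ∈ halfplane n) (x : U) :
    WithLp.toLp 2 (ampl (Matrix.blockDiagonal' Z) (φ Z x), f Z x) ∈ graphSpace f φ :=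
  Submodule.le_topologicalClosure _ (Submodule.subset_span ⟨Z, hZ, x, rfl⟩)

/-- On generators the inner product is `⟨f(Z)x, y⟩ - ⟨Zφ(Z)x, φ(Y)y⟩`. -/
theorem IsDiagDecomposition.mem_graphSpace_orthogonal {f : Tuple n → U →L[ℂ] U}
    {φ : Tuple n → U →L[ℂ] Tensor (TotalIndex n) X} (h : IsDiagDecomposition f φ)
    {Y : Tuple n} (hY : Y ∈ halfplane n) (y : U) :
    WithLp.toLp 2 (-φ Y y, y) ∈ (graphSpace f φ)ᗮ := by
  rw [graphSpace, Submodule.orthogonal_closure, Submodule.mem_orthogonal]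
  intro p hp
  induction hp using Submodule.span_induction with
  | mem p hp =>
    obtain ⟨Z, hZ, x, rfl⟩ := hp
    rw [WithLp.prod_inner_apply]
    simp [← h Z hZ Y hY]
  | zero => exact inner_zero_left _
  | add p q _ _ hp hq => rw [inner_add_left, hp, hq, add_zero]
  | smul c p _ hp => rw [inner_smul_left, hp, mul_zero]

theorem IsDiagDecomposition.map_mem_graphSpace {f : Tuple n → U →L[ℂ] U}
    {φ : Tuple n → U →L[ℂ] Tensor (TotalIndex n) X} (h : IsDiagDecomposition f φ)
    {ι : AUI U} {ιX : AUI X}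
    (hφ : IsRealFun ι (AUI.tensor (TotalIndex n) ιX) (halfplane n) φ) :
    ∀ p ∈ graphSpace f φ, (AUI.tensor (TotalIndex n) ιX).prod ι p ∈ graphSpace f φ := by
  intro p hp
  refine AUI.mem_closure_span _ ?_ hp
  rintro _ ⟨Z, hZ, x, rfl⟩
  refine ⟨conjTuple Z, conjTuple_mem_halfplane hZ, ι x, ?_⟩
  have h1 := hφ _ (conjTuple_mem_halfplane hZ) (ι x)
  have h2 := h.isRealFun hφ _ (conjTuple_mem_halfplane hZ) (ι x)
  rw [ι.invol, conjTuple_conjTuple] at h1 h2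
  rw [AUI.prod_toLp, AUI.tensor_ampl, h1, h2, blockDiagonal'_conjTuple]

/-- The eigenvectors of `T` produced by a realization. -/
theorem IsRealization.exists_apply_eq {f : Tuple n → U →L[ℂ] U}
    {T : WithLp 2 (Tensor (TotalIndex n) X × U) →L[ℂ] WithLp 2 (Tensor (TotalIndex n) X × U)}
    (hdef : DoubleCayleyDefined f) (hF : IsRealization (doubleCayley f) T) (hTT : T * T = 1)
    {Z : Tuple n} (hZ : Z ∈ halfplane n) :
    ∃ φ : U →L[ℂ] Tensor (TotalIndex n) X, ∀ x,
      T (WithLp.toLp 2 (ampl (Matrix.blockDiagonal' Z) (φ x), f Z x)) =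
        WithLp.toLp 2 (ampl (Matrix.blockDiagonal' Z) (φ x), f Z x) ∧
      T (WithLp.toLp 2 (-φ x, x)) = -WithLp.toLp 2 (-φ x, x) := by
  obtain ⟨W, hW, rfl⟩ := exists_disk_cayley_eq hZ
  obtain ⟨hu, hFW⟩ := hF W hW
  have hf1 := hdef W hW
  set D := Matrix.blockDiagonal' W with hD
  -- With `u = (f(Z)x + x)/2` and state `t = (1 - A W)⁻¹ B u`, the witness is `φ x = (1 - W) t`;
  -- then `Zφ x = (1 + W) t`.
  refine ⟨ampl (1 - D) ∘L Ring.inverse (1 - block11 T ∘L ampl D) ∘L block12 T ∘L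
    ((2 : ℂ)⁻¹ • (f (cayley W) + 1)), fun x => ?_⟩
  set u : U := ((2 : ℂ)⁻¹ • (f (cayley W) + 1)) x with hux
  have hu' : u = (2 : ℂ)⁻¹ • (f (cayley W) x + x) := rfl
  set t := Ring.inverse (1 - block11 T ∘L ampl D) (block12 T u) with ht
  have hx := apply_inverse_eq hu u
  rw [← hFW, ← ht] at hx
  have hFu : doubleCayley f W u = (2 : ℂ)⁻¹ • (f (cayley W) x - x) := by
    have e : Ring.inverse (f (cayley W) + 1) u = (2 : ℂ)⁻¹ • x := by
      rw [hux, smul_apply, map_smul, inverse_apply_apply hf1]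
    change (f (cayley W) - 1) (Ring.inverse (f (cayley W) + 1) u) = _
    rw [e, map_smul]
    rfl
  -- As `T² = 1`, it exchanges `(W t, u)` and `(t, F(W)u)`: their sum is fixed and their difference
  -- changes sign.
  have hy := congrArg T hx
  rw [← mul_apply_eq_comp, hTT, one_apply_eq_self] at hy
  change T (WithLp.toLp 2 (ampl (Matrix.blockDiagonal' (cayley W)) (ampl (1 - D) t), _)) =
    WithLp.toLp 2 (ampl (Matrix.blockDiagonal' (cayley W)) (ampl (1 - D) t), _) ∧
    T (WithLp.toLp 2 (-ampl (1 - D) t, x)) = -WithLp.toLp 2 (-ampl (1 - D) t, x)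
  have e1 : ampl (Matrix.blockDiagonal' (cayley W)) (ampl (1 - D) t) = ampl D t + t := by
    rw [← ampl_mul_apply, blockDiagonal'_cayley_mul hW, ampl_add, ampl_one, add_comm]
    rfl
  have e2 : -ampl (1 - D) t = ampl D t - t := by
    rw [ampl_sub, ampl_one]
    exact neg_sub t (ampl D t)
  have e3 : f (cayley W) x = u + doubleCayley f W u := by
    rw [hFu, hu', ← smul_add, add_add_sub_cancel, ← two_smul ℂ, inv_smul_smul₀ two_ne_zero]
  have e4 : x = u - doubleCayley f W u := by
    rw [hFu, hu', ← smul_sub, add_sub_sub_cancel, ← two_smul ℂ, inv_smul_smul₀ two_ne_zero]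
  rw [e1, e2, e3]
  constructor
  · rw [← Prod.mk_add_mk, WithLp.toLp_add, map_add, hx, ← hy, add_comm]
  · have e5 : WithLp.toLp 2 (ampl D t - t, x) =
        WithLp.toLp 2 (ampl D t, u) - WithLp.toLp 2 (t, doubleCayley f W u) := by
      conv_lhs => rw [e4]
      rfl
    rw [e5, map_sub, hx, ← hy, neg_sub]

variable [CompleteSpace U]

/-- Taking `Y = Z` gives `Re ⟨f(Z)x, x⟩ ≥ 0`, so `f(Z) + 1` is bounded below by `1`. -/
theorem IsDiagDecomposition.isUnit_add_one {f : Tuple n → U →L[ℂ] U}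
    {φ : Tuple n → U →L[ℂ] Tensor (TotalIndex n) X} (h : IsDiagDecomposition f φ)
    {Z : Tuple n} (hZ : Z ∈ halfplane n) : IsUnit (f Z + 1) := by
  obtain ⟨ε, hε, hpos⟩ :=
    exists_le_re_inner_ampl_of_add_conjTranspose (E := X) (posDef_blockDiagonal'_add hZ)
  refine ContinuousLinearMap.isUnit_of_forall_le_norm_inner_map _ (c := 1) one_pos fun x => ?_
  refine le_trans ?_ (Complex.re_le_norm _)
  have h1 := hpos (φ Z x)
  have h2 : (inner ℂ x x).re = ‖x‖ ^ 2 := inner_self_eq_norm_sq (𝕜 := ℂ) _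
  have h3 : (f Z + 1) x = f Z x + x := rfl
  rw [h3, inner_add_left, Complex.add_re, h2, h Z hZ Z hZ]
  have h4 : 0 ≤ ε * ‖φ Z x‖ ^ 2 := by positivity
  simp only [NNReal.coe_one, mul_one]
  linarith

theorem IsDiagDecomposition.doubleCayleyDefined {f : Tuple n → U →L[ℂ] U}
    {φ : Tuple n → U →L[ℂ] Tensor (TotalIndex n) X} (h : IsDiagDecomposition f φ) :
    DoubleCayleyDefined f :=
  fun _ hW => h.isUnit_add_one (cayley_mem_halfplane hW)

variable [CompleteSpace X]

/-- Write `v = (f(Z) + 1)⁻¹ x` and `φ(Z)v = (1 - W) t₀`, so that `Zφ(Z)v = (1 + W) t₀`. Then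
`(Zφ(Z)v, f(Z)v)` in the graph space and `(-φ(Z)v, v)` in its complement have sum `(2W t₀, x)` and
difference `(2t₀, F(W)x)`. -/
theorem IsDiagDecomposition.reflectionL_apply {f : Tuple n → U →L[ℂ] U}
    {φ : Tuple n → U →L[ℂ] Tensor (TotalIndex n) X} (h : IsDiagDecomposition f φ)
    {W : Tuple n} (hW : W ∈ disk n) (x : U) :
    ∃ t, reflectionL (graphSpace f φ)
      (WithLp.toLp 2 (ampl (Matrix.blockDiagonal' W) t, x)) =
        WithLp.toLp 2 (t, doubleCayley f W x) := by
  set Z := cayley W with hZdef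
  have hZ : Z ∈ halfplane n := cayley_mem_halfplane hW
  have hu := h.isUnit_add_one hZ
  set v : U := Ring.inverse (f Z + 1) x with hv
  have hx : f Z v + v = x := apply_inverse_apply hu x
  have hF : doubleCayley f W x = f Z v - v := rfl
  have hdet := (Matrix.isUnit_iff_isUnit_det _).1
    (isUnit_one_sub_of_posDef (posDef_one_sub_blockDiagonal' hW))
  set D := Matrix.blockDiagonal' W with hD
  set t0 : Tensor (TotalIndex n) X := ampl (1 - D)⁻¹ (φ Z v) with ht0
  have e1 : ampl (1 - D) t0 = φ Z v := by
    rw [ht0, ← ampl_mul_apply, Matrix.mul_nonsing_inv _ hdet, ampl_one]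
    rfl
  have e2 : ampl (Matrix.blockDiagonal' Z) (φ Z v) = t0 + ampl D t0 := by
    rw [← e1, ← ampl_mul_apply, hZdef, blockDiagonal'_cayley_mul hW, ampl_add, ampl_one]
    rfl
  have e3 : φ Z v = t0 - ampl D t0 := by
    rw [← e1, ampl_sub, ampl_one]
    rfl
  refine ⟨(2 : ℂ) • t0, ?_⟩
  have key := reflectionL_add (mem_graphSpace f φ hZ v) (h.mem_graphSpace_orthogonal hZ v)
  rw [← WithLp.toLp_add, ← WithLp.toLp_sub, Prod.mk_add_mk, Prod.mk_sub_mk, hx, ← hF, e2,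
    e3] at key
  convert key using 4
  · rw [map_smul, two_smul]; abel
  · rw [two_smul]; abel

theorem IsDiagDecomposition.isRealization {f : Tuple n → U →L[ℂ] U}
    {φ : Tuple n → U →L[ℂ] Tensor (TotalIndex n) X} (h : IsDiagDecomposition f φ) :
    IsRealization (doubleCayley f) (reflectionL (graphSpace f φ)) := by
  intro W hW
  have hu := isUnit_one_sub_block11 (adjoint_reflectionL (graphSpace f φ))
    (reflectionL_mul_self (graphSpace f φ))
    (norm_ampl_lt_one (E := X) (posDef_one_sub_blockDiagonal' hW))
  refine ⟨hu, ?_⟩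
  ext x
  obtain ⟨t, ht⟩ := h.reflectionL_apply hW x
  exact eq_inverse_of_apply_eq hu ht

/-- Eigenvectors for `1` and `-1` are orthogonal, which is the decomposition. Reality holds because
`T`, `f(Z)` and `x` determine `φ(Z)x`. -/
theorem IsRealization.exists_isDiagDecomposition {f : Tuple n → U →L[ℂ] U}
    {T : WithLp 2 (Tensor (TotalIndex n) X × U) →L[ℂ] WithLp 2 (Tensor (TotalIndex n) X × U)}
    (hdef : DoubleCayleyDefined f) (hF : IsRealization (doubleCayley f) T)
    (hT : ContinuousLinearMap.adjoint T = T) (hTT : T * T = 1) {ι : AUI U} {ιX : AUI X}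
    (hreal : IsRealOp ((AUI.tensor (TotalIndex n) ιX).prod ι)
      ((AUI.tensor (TotalIndex n) ιX).prod ι) T) :
    ∃ φ : Tuple n → U →L[ℂ] Tensor (TotalIndex n) X, IsDiagDecomposition f φ ∧
      IsRealFun ι (AUI.tensor (TotalIndex n) ιX) (halfplane n) φ := by
  choose! φ hφ using fun (Z : Tuple n) (hZ : Z ∈ halfplane n) =>
    hF.exists_apply_eq hdef hTT hZ
  refine ⟨φ, fun Z hZ Y hY x y => ?_, fun Z hZ x => ?_⟩
  · have h := inner_eq_zero_of_apply_eq hT (hφ Z hZ x).1 (hφ Y hY y).2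
    rw [WithLp.prod_inner_apply] at h
    simp only [inner_neg_right] at h
    exact (neg_add_eq_zero.1 h).symm
  · obtain ⟨h1, h2⟩ := hφ Z hZ x
    obtain ⟨h3, h4⟩ := hφ _ (conjTuple_mem_halfplane hZ) (ι x)
    set κ := AUI.tensor (TotalIndex n) ιX
    have h5 := hreal (WithLp.toLp 2
      (ampl (Matrix.blockDiagonal' (conjTuple Z)) (φ (conjTuple Z) (ι x)),
        f (conjTuple Z) (ι x)))
    have h6 := hreal (WithLp.toLp 2 (-φ (conjTuple Z) (ι x), ι x))
    rw [h3, AUI.prod_toLp, AUI.tensor_ampl, ← blockDiagonal'_conjTuple, conjTuple_conjTuple] at h5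
    rw [h4, AUI.map_neg, AUI.prod_toLp, κ.map_neg, ι.invol] at h6
    set g := κ (φ (conjTuple Z) (ι x))
    have h7 : T (WithLp.toLp 2 (ampl (Matrix.blockDiagonal' Z) (φ Z x), f Z x) -
        WithLp.toLp 2 (ampl (Matrix.blockDiagonal' Z) g, ι (f (conjTuple Z) (ι x)))) =
        WithLp.toLp 2 (ampl (Matrix.blockDiagonal' Z) (φ Z x), f Z x) -
        WithLp.toLp 2 (ampl (Matrix.blockDiagonal' Z) g, ι (f (conjTuple Z) (ι x))) := by
      rw [map_sub, h1, ← h5]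
    have h8 : T (WithLp.toLp 2 (-φ Z x, x) - WithLp.toLp 2 (-g, x)) =
        -(WithLp.toLp 2 (-φ Z x, x) - WithLp.toLp 2 (-g, x)) := by
      rw [map_sub, h2, ← h6]
      abel
    -- With `δ = φ(Z)x - g`, the eigenvector for `-1` is `(-δ, 0)` since the `x` cancel, so
    -- orthogonality leaves `⟨Zδ, δ⟩ = 0` and coercivity gives `δ = 0`.
    have h9 := inner_eq_zero_of_apply_eq hT h7 h8
    rw [← WithLp.toLp_sub, ← WithLp.toLp_sub, Prod.mk_sub_mk, Prod.mk_sub_mk, sub_self,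
      WithLp.prod_inner_apply] at h9
    simp only [inner_zero_right, add_zero] at h9
    rw [← map_sub, ← neg_sub', inner_neg_right, neg_eq_zero] at h9
    obtain ⟨ε, hε, hpos⟩ :=
      exists_le_re_inner_ampl_of_add_conjTranspose (E := X) (posDef_blockDiagonal'_add hZ)
    have h10 := hpos (φ Z x - g)
    rw [h9, Complex.zero_re] at h10
    have h11 : ‖φ Z x - g‖ ^ 2 ≤ 0 := by
      by_contra hne
      have := mul_pos hε (not_le.1 hne)
      linarith
    have h12 : ‖φ Z x - g‖ = 0 := pow_eq_zero_iff two_ne_zero |>.1 (le_antisymm h11 (sq_nonneg _))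
    exact (sub_eq_zero.1 (norm_eq_zero.1 h12)).symm

end Realization

end

end Bessmertnyi

/-! ### The equivalence. -/

open Bessmertnyi in
theorem mainTheorem4 {N : ℕ} (n : Fin N → ℕ)
    (U : Type u) [NormedAddCommGroup U] [InnerProductSpace ℂ U] [CompleteSpace U]
    (ι : AUI U) (f : Tuple n → U →L[ℂ] U) (hf : DifferentiableOn ℂ f (Omega n)) :
    List.TFAE [
      -- (i)
      MemBessmertnyi n U f ∧ IsRealFun ι ι (Omega n) f,
      -- (ii)
      ∃ (H : Type u) (_ : NormedAddCommGroup H) (_ : InnerProductSpace ℂ H) (_ : CompleteSpace H)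
        (M : Fin N → Type u) (_ : ∀ k, NormedAddCommGroup (M k))
        (_ : ∀ k, InnerProductSpace ℂ (M k)) (_ : ∀ k, CompleteSpace (M k))
        (G : ∀ k, WithLp 2 (U × H) →L[ℂ] Tensor (Fin (n k)) (M k))
        (ιH : AUI H) (ιM : ∀ k, AUI (M k)),
        IsLongResolvent f G ∧
        ∀ k, IsRealOp (ι.prod ιH) (AUI.tensor (Fin (n k)) (ιM k)) (G k),
      -- (iii)
      ∃ (M : Fin N → Type u) (_ : ∀ k, NormedAddCommGroup (M k))
        (_ : ∀ k, InnerProductSpace ℂ (M k)) (_ : ∀ k, CompleteSpace (M k))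
        (φ : ∀ k, Tuple n → U →L[ℂ] Tensor (Fin (n k)) (M k))
        (ιM : ∀ k, AUI (M k)),
        IsDecomposition f φ ∧
        ∀ k, IsRealFun ι (AUI.tensor (Fin (n k)) (ιM k)) (halfplane n) (φ k),
      -- (iv)
      DoubleCayleyDefined f ∧
      ∃ (X : Type u) (_ : NormedAddCommGroup X) (_ : InnerProductSpace ℂ X) (_ : CompleteSpace X)
        (T : WithLp 2 (Tensor (TotalIndex n) X × U) →L[ℂ] WithLp 2 (Tensor (TotalIndex n) X × U))
        (ιX : AUI X),
        IsRealization (doubleCayley f) T ∧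
        ContinuousLinearMap.adjoint T = T ∧ T * T = 1 ∧
        IsRealOp ((AUI.tensor (TotalIndex n) ιX).prod ι) ((AUI.tensor (TotalIndex n) ιX).prod ι) T
    ] := by
  tfae_have 1 → 2 := by
    rintro ⟨⟨-, H, _, _, _, M, _, _, _, G, hG⟩, hreal⟩
    obtain ⟨ιH⟩ := AUI.nonempty H
    let ιM : ∀ k, AUI (M k) := fun k => (AUI.nonempty (M k)).some
    refine ⟨WithLp 2 (H × H), inferInstance, inferInstance, inferInstance,
      fun k => WithLp 2 (M k × M k), inferInstance, inferInstance, inferInstance, _,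
      ιH.swap, fun k => (ιM k).swap, hG.double (hG.conjOp hreal ιH ιM), fun k => ?_⟩
    exact isRealOp_doubleOp ι ιH (ιM k) (G k)
  tfae_have 2 → 1 := by
    rintro ⟨H, _, _, _, M, _, _, _, G, ιH, ιM, hG, hreal⟩
    exact ⟨⟨hf, H, _, _, ‹_›, M, _, _, ‹_›, G, hG⟩, hG.isRealFun hreal⟩
  tfae_have 2 → 3 := by
    rintro ⟨H, _, _, _, M, _, _, _, G, ιH, ιM, hG, hreal⟩
    exact ⟨M, _, _, ‹_›, _, ιM, hG.isDecomposition, hG.isRealFun_decomposition hreal⟩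
  tfae_have 3 → 4 := by
    rintro ⟨M, _, _, _, φ, ιM, hφ, hreal⟩
    have h := hφ.isDiagDecomposition
    have hr : IsRealFun ι (AUI.tensor (TotalIndex n) (AUI.pi ιM)) (halfplane n)
        (fun Z => tensorColumn fun k => φ k Z) :=
      fun Z hZ x => AUI.tensor_tensorColumn ιM fun k => hreal k Z hZ x
    exact ⟨h.doubleCayleyDefined, PiLp 2 M, inferInstance, inferInstance, inferInstance,
      reflectionL (graphSpace f _), AUI.pi ιM, h.isRealization, adjoint_reflectionL _,
      reflectionL_mul_self _, isRealOp_reflectionL _ (h.map_mem_graphSpace hr)⟩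
  tfae_have 4 → 2 := by
    rintro ⟨hdef, X, _, _, _, T, ιX, hF, hT, hTT, hreal⟩
    -- No holomorphy of `φ` is required here: that of `f` suffices to reach (ii), from which (iii)
    -- follows.
    obtain ⟨φ, hφ, hr⟩ := hF.exists_isDiagDecomposition hdef hT hTT hreal
    exact ⟨stateSpace φ, inferInstance, inferInstance, inferInstance, fun _ => X, inferInstance,
      inferInstance, inferInstance, colligationComponent φ, _, fun _ => ιX,
      hφ.isLongResolvent hf, isRealOp_colligationComponent hr⟩
  tfae_finish
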